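/- Let $G$ be a second countable, locally compact (Hausdorff), unimodular group with Haar measure $\mu$, and let $(K_n)_{n\in\mathbb N}$ be a (right) strong Følner sequence in $G$, i.e. a sequence of nonnull compact sets with $\mu(K_nL\cap K_n^cL)/\mu(K_n)\to 0$ for every compact $L\subseteq G$ (such a sequence exists exactly when the unimodular group $G$ is amenable). Let $\pi$ be a projective discrete series representation of $G$ on a separable complex Hilbert space $\mathcal H$: a strongly measurable map $\pi:G\to\mathcal U(\mathcal H)$ with $\pi(x)\pi(y)=\sigma(x,y)\pi(xy)$ for some $\sigma:G\times G\to\mathbb T$, which is irreducible (no closed invariant subspaces other than $\{0\}$ and $\mathcal H$) and satisfies $\int_G|\langle h,\pi(x)h\rangle|^2\,d\mu(x)<\infty$ for some $h\neq0$. Then there is a unique $d_\pi>0$ (the formal degree of $\pi$) such that for all $f_1,f_2,g_1,g_2\in\mathcal H$ $$\int_G\langle f_1,\pi(x)g_1\rangle\langle\pi(x)g_2,f_2\rangle\,d\mu(x)=d_\pi^{-1}\langle f_1,f_2\rangle\overline{\langle g_1,g_2\rangle}$$ with absolutely convergent integral. Let $\Lambda\subseteq G$, and let $g\in\mathcal D_\pi$,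 i.e. $g\in\mathcal H$ and $\int_G\sup_{z\in Q}|\langle g,\pi(xz)g\rangle|^2\,d\mu(x)<\infty$ for some relatively compact symmetric neighborhood $Q$ of the identity. Consider the family $\pi(\Lambda)g=(\pi(\lambda)g)_{\lambda\in\Lambda}$. (i) If $\pi(\Lambda)g$ is a frame for $\mathcal H$, i.e. there are $A,B>0$ with $A\|f\|^2\le\sum_{\lambda\in\Lambda}|\langle f,\pi(\lambda)g\rangle|^2\le B\|f\|^2$ for all $f\in\mathcal H$, then the lower Beurling density $$D^-(\Lambda)=\lim_{n\to\infty}\inf_{x\in G}\frac{\#(\Lambda\cap xK_n)}{\mu(K_n)}$$ exists and $D^-(\Lambda)\ge d_\pi$. (ii) If $\pi(\Lambda)g$ is a Riesz sequence in $\mathcal H$, i.e. there are $A,B>0$ such that for all $c\in\ell^2(\Lambda)$ the series $\sum_{\lambda\in\Lambda}c_\lambda\pi(\lambda)g$ converges unconditionally and $A\|c\|^2\le\|\sum_{\lambda\in\Lambda}c_\lambda\pi(\lambda)g\|^2\le B\|c\|^2$, then the upper Beurling density $$D^+(\Lambda)=\lim_{n\to\infty}\sup_{x\in G}\frac{\#(\Lambda\cap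 xK_n)}{\mu(K_n)}$$ exists and $D^+(\Lambda)\le d_\pi$. -/

import Mathlib

open MeasureTheory Filter Topology
open scoped ENNReal Pointwise

namespace Coherent

/-- A strong Folner sequence with respect to the Haar measure `μ`: nonnull compact sets `K n` with
`μ (K n * L ∩ (K n)ᶜ * L) / μ (K n) → 0` for every compact set `L`. -/
structure IsStrongFolner {G : Type*} [Group G] [TopologicalSpace G] [MeasurableSpace G]
    (μ : Measure G) (K : ℕ → Set G) : Prop where
  isCompact : ∀ n, IsCompact (K n)
  nonnull : ∀ n, μ (K n) ≠ 0
  tendsto : ∀ L : Set G, IsCompact L →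
    Tendsto (fun n => μ ((K n * L) ∩ ((K n)ᶜ * L)) / μ (K n)) atTop (𝓝 0)

/-- `D` is the lower Beurling density of `Λ` along the sequence `K`: the limit
`lim_n inf_x #(Λ ∩ x K_n) / μ (K_n)` exists and equals `D`. -/
def HasLowerBeurlingDensity {G : Type*} [Group G] [MeasurableSpace G]
    (μ : Measure G) (K : ℕ → Set G) (Λ : Set G) (D : ℝ≥0∞) : Prop :=
  Tendsto (fun n => ⨅ x : G, ((Λ ∩ x • K n).encard : ℝ≥0∞) / μ (K n)) atTop (𝓝 D)

/-- `D` is the upper Beurling density of `Λ` along the sequence `K`: the limit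
`lim_n sup_x #(Λ ∩ x K_n) / μ (K_n)` exists and equals `D`. -/
def HasUpperBeurlingDensity {G : Type*} [Group G] [MeasurableSpace G]
    (μ : Measure G) (K : ℕ → Set G) (Λ : Set G) (D : ℝ≥0∞) : Prop :=
  Tendsto (fun n => ⨆ x : G, ((Λ ∩ x • K n).encard : ℝ≥0∞) / μ (K n)) atTop (𝓝 D)

/-- The family `e` is a frame for `H`. -/
def IsFrame {H ι : Type*} [NormedAddCommGroup H] [InnerProductSpace ℂ H] (e : ι → H) : Prop :=
  ∃ A B : ℝ, 0 < A ∧ 0 < B ∧ ∀ f : H,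
    Summable (fun i => ‖inner ℂ (e i) f‖ ^ 2) ∧
    A * ‖f‖ ^ 2 ≤ ∑' i, ‖inner ℂ (e i) f‖ ^ 2 ∧
    ∑' i, ‖inner ℂ (e i) f‖ ^ 2 ≤ B * ‖f‖ ^ 2

/-- The family `e` is a Riesz sequence in `H`. -/
def IsRieszSequence {H ι : Type*} [NormedAddCommGroup H] [InnerProductSpace ℂ H]
    (e : ι → H) : Prop :=
  ∃ A B : ℝ, 0 < A ∧ 0 < B ∧ ∀ c : lp (fun _ : ι => ℂ) 2,
    Summable (fun i => c i • e i) ∧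
    A * ‖c‖ ^ 2 ≤ ‖∑' i, c i • e i‖ ^ 2 ∧
    ‖∑' i, c i • e i‖ ^ 2 ≤ B * ‖c‖ ^ 2

/-- The local maximal function `M_Q F (x) = sup_{z ∈ Q} |F (x z)|`, with values in `[0, ∞]`. -/
noncomputable def localMaximal {G : Type*} [Group G] (Q : Set G) (F : G → ℂ) (x : G) : ℝ≥0∞ :=
  ⨆ z ∈ Q, ‖F (x * z)‖ₑ

/-- A projective unitary representation of `G` on `H`: a strongly measurable map `π` into the
unitary operators with `π x ∘ π y = σ (x, y) • π (x y)` for a circle-valued function `σ`. -/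
structure ProjectiveRep (G H : Type*) [Group G] [MeasurableSpace G]
    [NormedAddCommGroup H] [InnerProductSpace ℂ H] where
  op : G → H ≃ₗᵢ[ℂ] H
  cocycle : G → G → Circle
  op_op : ∀ (x y : G) (v : H), op x (op y v) = (cocycle x y : ℂ) • op (x * y) v
  stronglyMeasurable : ∀ v : H, StronglyMeasurable (fun x => op x v)

namespace ProjectiveRep

/-- The coefficient transform `V_g f (x) = ⟨f, π(x) g⟩`, where the bracket is linear in the first
variable; Mathlib's `inner` is linear in the second one. -/
noncomputable def coeff {G H : Type*} [Group G] [MeasurableSpace G] [NormedAddCommGroup H]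
    [InnerProductSpace ℂ H] (π : ProjectiveRep G H) (g f : H) (x : G) : ℂ :=
  inner ℂ (π.op x g) f

/-- The only closed invariant subspaces are `0` and `H`. -/
def IsIrreducible {G H : Type*} [Group G] [MeasurableSpace G] [NormedAddCommGroup H]
    [InnerProductSpace ℂ H] (π : ProjectiveRep G H) : Prop :=
  ∀ W : Submodule ℂ H, IsClosed (W : Set H) → (∀ x, ∀ v ∈ W, π.op x v ∈ W) → W = ⊥ ∨ W = ⊤

/-- Projective discrete series: irreducible and square-integrable. -/
def IsDiscreteSeries {G H : Type*} [Group G] [MeasurableSpace G] [NormedAddCommGroup H]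
    [InnerProductSpace ℂ H] (π : ProjectiveRep G H) (μ : Measure G) : Prop :=
  π.IsIrreducible ∧ ∃ g : H, g ≠ 0 ∧ Integrable (fun x => ‖π.coeff g g x‖ ^ 2) μ

/-- `d` is the formal degree of `π`: it is positive and the orthogonality relations
`∫ ⟨f₁, π(x) g₁⟩ ⟨π(x) g₂, f₂⟩ dμ(x) = d⁻¹ ⟨f₁, f₂⟩ conj ⟨g₁, g₂⟩` hold (brackets linear in the
first variable, as in `coeff`), the integrals being absolutely convergent. -/
def IsFormalDegree {G H : Type*} [Group G] [MeasurableSpace G] [NormedAddCommGroup H]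
    [InnerProductSpace ℂ H] (π : ProjectiveRep G H) (μ : Measure G) (d : ℝ) : Prop :=
  0 < d ∧ ∀ f₁ f₂ g₁ g₂ : H,
    Integrable (fun x => π.coeff g₁ f₁ x * (starRingEnd ℂ) (π.coeff g₂ f₂ x)) μ ∧
    ∫ x, π.coeff g₁ f₁ x * (starRingEnd ℂ) (π.coeff g₂ f₂ x) ∂μ =
      (d : ℂ)⁻¹ * inner ℂ f₂ f₁ * (starRingEnd ℂ) (inner ℂ g₂ g₁)

/-- The set of localized vectors: those `g` for which `M_Q (V_g g)` is in `L²(G)`, where `Q` is a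
relatively compact symmetric unit neighborhood. The set does not depend on `Q`; membership for some
`Q` is required. -/
def localized {G H : Type*} [Group G] [TopologicalSpace G] [MeasurableSpace G]
    [NormedAddCommGroup H] [InnerProductSpace ℂ H] (π : ProjectiveRep G H) (μ : Measure G) :
    Set H :=
  {g | ∃ Q : Set G, Q ∈ 𝓝 (1 : G) ∧ IsCompact (closure Q) ∧ Q⁻¹ = Q ∧
    ∫⁻ x, localMaximal Q (π.coeff g g) x ^ 2 ∂μ < ∞}

end ProjectiveRep

end Coherent

/-! Attach to the system a dual family `h l` and consider the kernel `k(x) = ∑ l, ⟨π l g, π x g⟩ ⟨π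
x g, h l⟩`, integrated over a large compact set `K` in two ways.

Pointwise: for a frame with its canonical dual, `k(x) = ‖g‖²` for every `x`; for a Riesz sequence
with its biorthogonal family, `k(x)` is the quadratic form of an orthogonal projection at `π x g`,
so `|k(x)| ≤ ‖g‖²`. Term by term: by the orthogonality relations the `l`-th summand has integral
over `G` equal, up to complex conjugation of the pairing, to `d⁻¹ ‖g‖² ⟨π l g, h l⟩`. This pairing
has modulus at most `1` for a frame and equals `1` for a Riesz sequence. If the integral over `K` is
replaced by the sum of the full integrals over `l ∈ Λ ∩ K`, the first case gives `‖g‖² μ K ≲ d⁻¹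
‖g‖² #(Λ ∩ K)` and the second gives the reverse inequality.

The replacement costs `ε μ K` plus a multiple of the measure of a boundary of `K`
(`exists_tsum_truncationError_le`). Only `g` is localized; the `h l` are merely Bessel. A weighted
Cauchy inequality puts the small tail of `M_Q (V_g g)` on one factor and the Bessel bound or the
formal degree on the other. Passing from sums over `Λ` to integrals needs `Λ` to be relatively
separated, which the Bessel bound forces (`exists_isSeparated_of_isBessel`). Along a strong Følner
sequence the boundary term is negligible, uniformly in translates.

Existence of the limits defining the densities is a separate averaging argument. The formal degree
comes from Schur's lemma applied to the possibly unbounded coefficient map through its closed graph,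
together with unimodularity. -/

namespace Coherent

/-! ### Hilbert space preliminaries and Schur's lemma -/

/-- A bounded operator that is bounded below has a bounded left inverse `Y` for which `X ∘ Y` is a
contraction (namely the orthogonal projection onto the range). -/
theorem exists_leftInverse_of_le_norm {E F : Type*} [NormedAddCommGroup E] [InnerProductSpace ℂ E]
    [CompleteSpace E] [NormedAddCommGroup F] [InnerProductSpace ℂ F] [CompleteSpace F]
    (X : E →L[ℂ] F) {A : ℝ} (hA : 0 < A) (h : ∀ v, A * ‖v‖ ^ 2 ≤ ‖X v‖ ^ 2) :
    ∃ Y : F →L[ℂ] E, (∀ v, Y (X v) = v) ∧ ∀ w, ‖X (Y w)‖ ≤ ‖w‖ := by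
  have hanti : AntilipschitzWith (Real.toNNReal (Real.sqrt A)⁻¹) X := by
    refine ContinuousLinearMap.antilipschitz_of_bound X fun v => ?_
    rw [Real.coe_toNNReal _ (by positivity), inv_mul_eq_div, le_div_iff₀ (Real.sqrt_pos.2 hA)]
    refine le_of_sq_le_sq ?_ (norm_nonneg _)
    rw [mul_pow, Real.sq_sqrt hA.le, mul_comm]
    exact h v
  have hinj := hanti.injective
  have hclo := hanti.isClosed_range X.uniformContinuous
  let e := X.equivRange hinj hclo
  have : CompleteSpace X.range := hclo.completeSpace_coe
  have hXe : ∀ w, X (e.symm w) = w := fun w => by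
    have := congrArg Subtype.val (e.apply_symm_apply w)
    rw [← this]
    rfl
  refine ⟨(e.symm : X.range →L[ℂ] E) ∘L X.range.orthogonalProjectionOnto, fun v => ?_, fun w => ?_⟩
  · apply hinj
    simp only [ContinuousLinearMap.comp_apply, ContinuousLinearEquiv.coe_coe]
    rw [hXe]
    exact Submodule.starProjection_eq_self_iff.2 ⟨v, rfl⟩
  · simp only [ContinuousLinearMap.comp_apply, ContinuousLinearEquiv.coe_coe]
    rw [hXe]
    exact X.range.norm_starProjection_apply_le w

/-- Polarization: a sesquilinear map is determined by its diagonal. -/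
theorem sesquilinear_eq_of_diagonal_eq {H : Type*} [AddCommGroup H] [Module ℂ H]
    (B C : H →ₗ[ℂ] H →ₗ⋆[ℂ] ℂ) (h : ∀ v, B v v = C v v) (u v : H) : B u v = C u v := by
  have h₁ := h (u + v)
  have h₂ := h (u + Complex.I • v)
  simp only [map_add, map_smul, LinearMap.add_apply, LinearMap.smul_apply, map_smulₛₗ,
    Complex.conj_I, smul_eq_mul, h u, h v] at h₁ h₂
  -- `h₁` compares the sums `B u v + B v u`; `h₂`, multiplied by `i`, compares the differences `B u
  -- v - B v u`.
  linear_combination (1 / 2 : ℂ) * h₁ + (1 / 2 : ℂ) * Complex.I * h₂ +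
    (1 / 2 : ℂ) * (B u v - B v u + C v u - C u v) * Complex.I_mul_I

namespace ProjectiveRep

variable {G H : Type*} [Group G] [MeasurableSpace G] [NormedAddCommGroup H]
  [InnerProductSpace ℂ H]

/-- **Schur's lemma** for bounded self-adjoint operators. -/
theorem IsIrreducible.exists_eq_smul [CompleteSpace H] {π : ProjectiveRep G H}
    (hπ : π.IsIrreducible) (T : H →L[ℂ] H) (hT : IsSelfAdjoint T)
    (hc : ∀ x v, T (π.op x v) = π.op x (T v)) : ∃ c : ℝ, ∀ v, T v = (c : ℂ) • v := by
  rcases subsingleton_or_nontrivial H with hH | hH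
  · exact ⟨0, fun v => Subsingleton.elim _ _⟩
  obtain ⟨a, ha⟩ : (spectrum ℝ T).Nonempty := ContinuousFunctionalCalculus.spectrum_nonempty T hT
  by_cases hs : ∀ b ∈ spectrum ℝ T, b = a
  · refine ⟨a, fun v => ?_⟩
    have h₁ : cfc (fun _ : ℝ => a) T = T := by
      conv_rhs => rw [← cfc_id ℝ T]
      exact cfc_congr fun b hb => (hs b hb).symm
    rw [cfc_const a T] at h₁
    conv_lhs => rw [← h₁]
    simp [Algebra.algebraMap_eq_smul_one]
  push Not at hs
  obtain ⟨b, hb, hab⟩ := hs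
  exfalso
  have hδ : 0 < |b - a| / 2 := half_pos (abs_pos.2 (sub_ne_zero.2 hab))
  -- Two distinct spectral points give tent functions of radius half their distance. Their product
  -- vanishes, but neither is zero on the spectrum.
  let f : ℝ → ℝ → ℝ := fun p t => max (|b - a| / 2 - |t - p|) 0
  have hf : ∀ p, Continuous (f p) := fun p => by fun_prop
  have hne : ∀ p ∈ spectrum ℝ T, cfc (f p) T ≠ 0 := fun p hp h0 => by
    rw [← cfc_const_zero ℝ T] at h0
    replace h0 := (cfc_eq_cfc_iff_eqOn hT (hf p).continuousOn continuousOn_const).1 h0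
    have := h0 hp
    simp only [f, sub_self, abs_zero, sub_zero] at this
    rw [max_eq_left hδ.le] at this
    exact hδ.ne' this
  have hmul : cfc (f a) T * cfc (f b) T = 0 := by
    rw [← cfc_mul _ _ T (hf a).continuousOn (hf b).continuousOn, ← cfc_const_zero ℝ T]
    refine cfc_congr fun t _ => ?_
    simp only [f]
    have := abs_sub_le b t a
    rw [abs_sub_comm b t] at this
    rcases le_total (|b - a| / 2) (|t - a|) with h | h
    · rw [max_eq_right (by linarith), zero_mul]
    · rw [max_eq_right (a := |b - a| / 2 - |t - b|) (by linarith), mul_zero]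
  have hcomm : ∀ x v, cfc (f a) T (π.op x v) = π.op x (cfc (f a) T v) := fun x v => by
    have : Commute T ((π.op x).toContinuousLinearEquiv : H →L[ℂ] H) :=
      ContinuousLinearMap.ext fun v => hc x v
    exact congrArg (fun S : H →L[ℂ] H => S v) (this.cfc_real (f a)).eq
  -- The kernel of `f a (T)` is closed and invariant. If it is `⊥`, the product relation kills `f b
  -- (T)`; if it is `⊤`, then `f a (T) = 0`. Both are excluded.
  rcases hπ (cfc (f a) T).ker (cfc (f a) T).isClosed_ker
    (fun x v hv => by
      rw [LinearMap.mem_ker] at hv ⊢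
      exact (hcomm x v).trans (by rw [show cfc (f a) T v = 0 from hv, map_zero])) with h | h
  · refine hne b hb (ContinuousLinearMap.ext fun v => ?_)
    have hv : cfc (f b) T v ∈ (cfc (f a) T).ker :=
      congrArg (fun S : H →L[ℂ] H => S v) hmul
    rw [h] at hv
    exact hv
  · refine hne a ha (ContinuousLinearMap.ext fun v => ?_)
    have hv : v ∈ (cfc (f a) T).ker := h ▸ Submodule.mem_top
    exact hv

end ProjectiveRep

/-! ### Covariance of the coefficient transform -/

namespace ProjectiveRep

section Coeff

variable {G H : Type*} [Group G] [MeasurableSpace G] [NormedAddCommGroup H]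
  [InnerProductSpace ℂ H] (π : ProjectiveRep G H)

theorem stronglyMeasurable_coeff (g f : H) : StronglyMeasurable (π.coeff g f) :=
  (π.stronglyMeasurable g).inner stronglyMeasurable_const

theorem coeff_add_right (g f₁ f₂ : H) (x : G) :
    π.coeff g (f₁ + f₂) x = π.coeff g f₁ x + π.coeff g f₂ x := inner_add_right _ _ _

theorem coeff_smul_right (g f : H) (c : ℂ) (x : G) :
    π.coeff g (c • f) x = c * π.coeff g f x := inner_smul_right _ _ _

theorem coeff_add_left (g₁ g₂ f : H) (x : G) :
    π.coeff (g₁ + g₂) f x = π.coeff g₁ f x + π.coeff g₂ f x := by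
  simp [coeff]

theorem coeff_smul_left (g f : H) (c : ℂ) (x : G) :
    π.coeff (c • g) f x = (starRingEnd ℂ) c * π.coeff g f x := by
  simp [coeff, mul_comm]

theorem norm_coeff_le (g f : H) (x : G) : ‖π.coeff g f x‖ ≤ ‖g‖ * ‖f‖ := by
  simpa [coeff] using norm_inner_le_norm (𝕜 := ℂ) (π.op x g) f

theorem op_one (v : H) : π.op 1 v = (π.cocycle 1 1 : ℂ) • v := by
  obtain ⟨w, rfl⟩ := (π.op 1).surjective v
  simpa using π.op_op 1 1 w

theorem coeff_op (g f : H) (y x : G) :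
    π.coeff g (π.op y f) x = π.cocycle y (y⁻¹ * x) * π.coeff g f (y⁻¹ * x) := by
  have h := π.op_op y (y⁻¹ * x) g
  rw [mul_inv_cancel_left] at h
  have h₂ : inner ℂ (π.op y (π.op (y⁻¹ * x) g)) (π.op y f) = π.coeff g f (y⁻¹ * x) :=
    (π.op y).inner_map_map _ _
  rw [h, inner_smul_left, ← Circle.coe_inv_eq_conj] at h₂
  rw [← h₂, ← mul_assoc, ← Circle.coe_mul, mul_inv_cancel, Circle.coe_one, one_mul]
  rfl

theorem norm_coeff_op (g f : H) (y x : G) :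
    ‖π.coeff g (π.op y f) x‖ = ‖π.coeff g f (y⁻¹ * x)‖ := by
  rw [coeff_op, norm_mul, Circle.norm_coe, one_mul]

/-- The two cocycle phases cancel, so `L²` pairings of coefficients are exactly invariant under the
representation. This is what makes the operator in the Schur argument commute with `π`. -/
theorem conj_coeff_op_mul (g f₁ f₂ : H) (y x : G) :
    (starRingEnd ℂ) (π.coeff g (π.op y f₁) x) * π.coeff g (π.op y f₂) x =
      (starRingEnd ℂ) (π.coeff g f₁ (y⁻¹ * x)) * π.coeff g f₂ (y⁻¹ * x) := by
  have h : (starRingEnd ℂ) (π.cocycle y (y⁻¹ * x) : ℂ) * π.cocycle y (y⁻¹ * x) = 1 := by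
    rw [← Circle.coe_inv_eq_conj, ← Circle.coe_mul, inv_mul_cancel, Circle.coe_one]
  rw [coeff_op, coeff_op, map_mul]
  linear_combination (starRingEnd ℂ) (π.coeff g f₁ (y⁻¹ * x)) * π.coeff g f₂ (y⁻¹ * x) * h

/-- Inversion exchanges window and vector up to a phase; with an inversion invariant measure the
`L²` norm of a coefficient becomes symmetric in the two. -/
theorem norm_coeff_inv (g f : H) (x : G) : ‖π.coeff g f x⁻¹‖ = ‖π.coeff f g x‖ := by
  have h : ‖π.coeff g (π.op x f) 1‖ = ‖π.coeff g f x⁻¹‖ := by simpa using π.norm_coeff_op g f x 1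
  rw [← h]
  simp only [coeff, op_one]
  rw [inner_smul_left, norm_mul, RCLike.norm_conj, Circle.norm_coe, one_mul, norm_inner_symm]

/-- The distance from `π u g` to the circle of unimodular multiples of `g`. -/
theorem exists_norm_op_sub_smul_le (g : H) (u : G) :
    ∃ t : ℂ, ‖t‖ = 1 ∧ ‖π.op u g - t • g‖ ^ 2 = 2 * (‖g‖ ^ 2 - ‖π.coeff g g u‖) := by
  obtain ⟨t, ht, h⟩ : ∃ t : ℂ, ‖t‖ = 1 ∧ t * π.coeff g g u = ‖π.coeff g g u‖ := by
    by_cases h0 : π.coeff g g u = 0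
    · exact ⟨1, by simp, by simp [h0]⟩
    · refine ⟨‖π.coeff g g u‖ / π.coeff g g u, by simp [h0], ?_⟩
      field_simp
  refine ⟨t, ht, ?_⟩
  rw [norm_sub_sq (𝕜 := ℂ), inner_smul_right]
  rw [show inner ℂ (π.op u g) g = π.coeff g g u from rfl, h, LinearIsometryEquiv.norm_map,
    norm_smul, ht, one_mul]
  simp
  ring

end Coeff

/-! ### Orthogonality relations for a fixed window -/

section Orthogonality

variable {G H : Type*} [Group G] [MeasurableSpace G] [NormedAddCommGroup H]
  [InnerProductSpace ℂ H] (π : ProjectiveRep G H) (μ : Measure G)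

/-- The vectors whose coefficient against `g` is square integrable. -/
def sqIntegrable (g : H) : Submodule ℂ H where
  carrier := {f | MemLp (π.coeff g f) 2 μ}
  add_mem' {a b} ha hb := by
    refine (MemLp.add ha hb).congr_norm (π.stronglyMeasurable_coeff _ _).aestronglyMeasurable ?_
    exact Eventually.of_forall fun x => by simp [coeff_add_right]
  zero_mem' := by
    have h : π.coeff g 0 = 0 := funext fun x => inner_zero_right _
    change MemLp (π.coeff g 0) 2 μ
    exact h ▸ MemLp.zero
  smul_mem' c f hf := by
    refine (MemLp.const_smul hf c).congr_norm
      (π.stronglyMeasurable_coeff _ _).aestronglyMeasurable ?_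
    exact Eventually.of_forall fun x => by simp [coeff_smul_right]

theorem mem_sqIntegrable {g f : H} : f ∈ π.sqIntegrable μ g ↔ MemLp (π.coeff g f) 2 μ := Iff.rfl

theorem op_mem_sqIntegrable [MeasurableMul G] [μ.IsMulLeftInvariant] {g f : H} (y : G)
    (hf : f ∈ π.sqIntegrable μ g) : π.op y f ∈ π.sqIntegrable μ g := by
  rw [mem_sqIntegrable] at hf ⊢
  refine (hf.comp_measurePreserving (measurePreserving_mul_left μ y⁻¹)).congr_norm
    (π.stronglyMeasurable_coeff _ _).aestronglyMeasurable ?_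
  exact Eventually.of_forall fun x => (π.norm_coeff_op _ _ _ _).symm

/-- The graph of the coefficient map `f ↦ V_g f`, inside `H × L²(G)`. -/
def coeffGraph (g : H) : Submodule ℂ (WithLp 2 (H × Lp ℂ 2 μ)) where
  carrier := {p | p.snd =ᵐ[μ] π.coeff g p.fst}
  add_mem' {a b} ha hb := by
    simp only [Set.mem_ofPred_eq, WithLp.add_snd, WithLp.add_fst] at *
    filter_upwards [ha, hb, Lp.coeFn_add a.snd b.snd] with x h₁ h₂ h₃
    rw [h₃, Pi.add_apply, h₁, h₂, coeff_add_right]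
  zero_mem' := by
    simp only [Set.mem_ofPred_eq, WithLp.zero_snd, WithLp.zero_fst]
    filter_upwards [Lp.coeFn_zero ℂ 2 μ] with x h
    exact h.trans (inner_zero_right _).symm
  smul_mem' c a ha := by
    simp only [Set.mem_ofPred_eq, WithLp.smul_snd, WithLp.smul_fst] at *
    filter_upwards [ha, Lp.coeFn_smul c a.snd] with x h₁ h₂
    rw [h₂, Pi.smul_apply, h₁, coeff_smul_right, smul_eq_mul]

/-- Convergence in `L²` yields an almost everywhere convergent subsequence, while norm convergence
in `H` gives pointwise convergence of coefficients, so the limits agree. -/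
theorem isClosed_coeffGraph (g : H) :
    IsClosed (π.coeffGraph μ g : Set (WithLp 2 (H × Lp ℂ 2 μ))) := by
  refine IsSeqClosed.isClosed fun p q hp hpq => ?_
  have h₁ : Tendsto (fun n => (p n).fst) atTop (𝓝 q.fst) :=
    ((WithLp.fstL 2 ℂ H (Lp ℂ 2 μ)).continuous.tendsto q).comp hpq
  have h₂ : Tendsto (fun n => (p n).snd) atTop (𝓝 q.snd) :=
    ((WithLp.sndL 2 ℂ H (Lp ℂ 2 μ)).continuous.tendsto q).comp hpq
  obtain ⟨ns, hns, hae⟩ := (tendstoInMeasure_of_tendsto_Lp h₂).exists_seq_tendsto_ae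
  have hall : ∀ᵐ x ∂μ, ∀ n, (p n).snd x = π.coeff g (p n).fst x :=
    ae_all_iff.2 fun n => hp n
  change q.snd =ᵐ[μ] π.coeff g q.fst
  filter_upwards [hae, hall] with x hx hx'
  refine tendsto_nhds_unique hx ?_
  simp only [hx']
  exact (tendsto_const_nhds (x := π.op x g)).inner (h₁.comp hns.tendsto_atTop)

/-- Every admissible vector gives a multiple of an isometry. -/
theorem exists_integral_coeff_eq_of_window [CompleteSpace H] [MeasurableMul G]
    [μ.IsMulLeftInvariant] (hπ : π.IsIrreducible) {g f₀ : H} (hf₀ : f₀ ≠ 0)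
    (hmem : f₀ ∈ π.sqIntegrable μ g) :
    ∃ c : ℝ, ∀ f, f ∈ π.sqIntegrable μ g ∧
      ∀ f', ∫ x, (starRingEnd ℂ) (π.coeff g f' x) * π.coeff g f x ∂μ = c * inner ℂ f' f := by
  have hcl := π.isClosed_coeffGraph μ g
  have : CompleteSpace (π.coeffGraph μ g) := hcl.completeSpace_coe
  -- With the graph norm, `j` projects the graph of `V_g` to its domain, and `j j*` is `(1 + V_g*
  -- V_g)⁻¹`: a bounded self-adjoint operator even though `V_g` is so far only closed.
  let j : π.coeffGraph μ g →L[ℂ] H :=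
    (WithLp.fstL 2 ℂ H (Lp ℂ 2 μ)) ∘L (π.coeffGraph μ g).subtypeL
  let lift : ∀ f, f ∈ π.sqIntegrable μ g → π.coeffGraph μ g := fun f hf =>
    ⟨WithLp.toLp 2 (f, MemLp.toLp _ hf), MemLp.coeFn_toLp hf⟩
  have hj : ∀ f hf, j (lift f hf) = f := fun f hf => rfl
  let T : H →L[ℂ] H := j ∘L ContinuousLinearMap.adjoint j
  have hTmem : ∀ h, T h ∈ π.sqIntegrable μ g := fun h =>
    (memLp_congr_ae (ContinuousLinearMap.adjoint j h).2).1 (Lp.memLp _)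
  have hweak : ∀ h, ∀ f' ∈ π.sqIntegrable μ g, inner ℂ f' (T h) +
      ∫ x, (starRingEnd ℂ) (π.coeff g f' x) * π.coeff g (T h) x ∂μ = inner ℂ f' h := by
    intro h f' hf'
    have h₁ := ContinuousLinearMap.adjoint_inner_right j (lift f' hf') h
    rw [hj, Submodule.coe_inner, WithLp.prod_inner_apply, L2.inner_def] at h₁
    rw [← h₁]
    congr 1
    refine integral_congr_ae ?_
    filter_upwards [(ContinuousLinearMap.adjoint j h).2, MemLp.coeFn_toLp hf'] with x hx hx'
    rw [RCLike.inner_apply']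
    exact (congrArg₂ (fun a b => (starRingEnd ℂ) a * b) hx' hx).symm
  -- The closure of the domain of `V_g` is invariant and contains `f₀ ≠ 0`, so irreducibility makes
  -- the domain dense.
  have hdense : ∀ u, (∀ f' ∈ π.sqIntegrable μ g, inner ℂ f' u = 0) → u = 0 := by
    intro u hu
    have htop : (π.sqIntegrable μ g).topologicalClosure = ⊤ := by
      refine (hπ _ (Submodule.isClosed_topologicalClosure _) fun x v hv => ?_).resolve_left ?_
      · exact map_mem_closure (π.op x).continuous hv fun w hw => π.op_mem_sqIntegrable μ x hw
      · intro h
        exact hf₀ ((Submodule.mem_bot ℂ).1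
          (h ▸ Submodule.le_topologicalClosure _ hmem))
    have : u ∈ (π.sqIntegrable μ g)ᗮ := (Submodule.mem_orthogonal _ _).2 hu
    rw [Submodule.topologicalClosure_eq_top_iff.1 htop] at this
    exact (Submodule.mem_bot ℂ).1 this
  -- a vector solving the weak equation for `h` is `T h`
  have huniq : ∀ h, ∀ u ∈ π.sqIntegrable μ g, (∀ f' ∈ π.sqIntegrable μ g, inner ℂ f' u +
      ∫ x, (starRingEnd ℂ) (π.coeff g f' x) * π.coeff g u x ∂μ = inner ℂ f' h) → T h = u := by
    intro h u hu hf
    let p := lift u hu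
    have hadj : ContinuousLinearMap.adjoint j h = p := by
      refine ext_inner_left ℂ fun q => ?_
      have hq : q.1.fst ∈ π.sqIntegrable μ g := (memLp_congr_ae q.2).1 (Lp.memLp _)
      rw [ContinuousLinearMap.adjoint_inner_right, Submodule.coe_inner, WithLp.prod_inner_apply,
        L2.inner_def]
      refine (hf _ hq).symm.trans ?_
      congr 1
      refine integral_congr_ae ?_
      filter_upwards [q.2, MemLp.coeFn_toLp hu] with x hx hx'
      rw [RCLike.inner_apply']
      exact (congrArg₂ (fun a b => (starRingEnd ℂ) a * b) hx hx').symm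
    change j (ContinuousLinearMap.adjoint j h) = u
    rw [hadj]
    exact hj u hu
  -- By uniqueness of weak solutions it suffices that `π y (T v)` solves the equation for `π y v`,
  -- which follows from left invariance.
  have hcomm : ∀ x v, T (π.op x v) = π.op x (T v) := by
    intro y v
    refine huniq _ _ (π.op_mem_sqIntegrable μ y (hTmem v)) fun f' hf' => ?_
    obtain ⟨f'', rfl⟩ : ∃ f'', f' = π.op y f'' := ⟨(π.op y).symm f', by simp⟩
    have hf'' : f'' ∈ π.sqIntegrable μ g := by
      have h₁ := π.op_mem_sqIntegrable μ y⁻¹ hf'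
      rw [op_op, inv_mul_cancel, op_one, smul_smul, ← Circle.coe_mul] at h₁
      exact ((π.sqIntegrable μ g).smul_mem_iff (Circle.coe_ne_zero _)).1 h₁
    rw [LinearIsometryEquiv.inner_map_map, LinearIsometryEquiv.inner_map_map, ← hweak v f'' hf'']
    congr 1
    simp only [conj_coeff_op_mul]
    exact integral_mul_left_eq_self
      (fun x => (starRingEnd ℂ) (π.coeff g f'' x) * π.coeff g (T v) x) y⁻¹
  have hsa : IsSelfAdjoint T := by
    rw [ContinuousLinearMap.isSelfAdjoint_iff']
    simp [T, ContinuousLinearMap.adjoint_comp]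
  obtain ⟨c, hc⟩ := hπ.exists_eq_smul T hsa hcomm
  have hc0 : (c : ℂ) ≠ 0 := by
    intro h0
    refine hf₀ (hdense _ fun f' hf' => ?_)
    rw [← hweak f₀ f' hf', hc, h0]
    simp [coeff]
  have hall : ∀ f, f ∈ π.sqIntegrable μ g := fun f =>
    ((π.sqIntegrable μ g).smul_mem_iff hc0).1 (hc f ▸ hTmem f)
  -- With `T = c` the weak equation reads `c (⟨f', f⟩ + ⟨V f', V f⟩) = ⟨f', f⟩`; solving for the
  -- second pairing gives this constant.
  refine ⟨c⁻¹ - 1, fun f => ⟨hall f, fun f' => ?_⟩⟩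
  have h₁ := hweak f f' (hall f')
  simp only [hc, coeff_smul_right, inner_smul_right, mul_left_comm _ (c : ℂ)] at h₁
  rw [integral_const_mul] at h₁
  push_cast
  field_simp
  linear_combination h₁

theorem integral_conj_mul_coeff_self (g f : H) :
    ∫ x, (starRingEnd ℂ) (π.coeff g f x) * π.coeff g f x ∂μ =
      ((∫ x, ‖π.coeff g f x‖ ^ 2 ∂μ : ℝ) : ℂ) := by
  rw [← integral_complex_ofReal]
  congr 1
  ext x
  rw [mul_comm, RCLike.mul_conj]
  norm_cast

end Orthogonality

end ProjectiveRep

/-! ### Inversion invariance of Haar measure -/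

section Unimodular

variable {G : Type*} [Group G] [TopologicalSpace G] [IsTopologicalGroup G]
  [LocallyCompactSpace G] [SecondCountableTopology G] [MeasurableSpace G] [BorelSpace G]

/-- A Haar measure on a unimodular group is invariant under inversion. -/
theorem isInvInvariant_of_isMulRightInvariant (μ : Measure G) [μ.IsHaarMeasure]
    [μ.IsMulRightInvariant] : μ.IsInvInvariant := by
  constructor
  let c : ℝ≥0∞ := Measure.haarScalarFactor μ.inv μ
  -- Right invariance of `μ` makes `μ.inv` left invariant, so it is a multiple of `μ`; inverting
  -- twice then forces `c ^ 2 = 1`.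
  have hc : μ.inv = c • μ := Measure.isMulLeftInvariant_eq_smul μ.inv μ
  have hcc : Measure.map Inv.inv (Measure.map Inv.inv μ) = c ^ 2 • μ := by
    rw [← Measure.inv_def μ, hc, Measure.map_smul, ← Measure.inv_def μ, hc, smul_smul, pow_two]
  have μeq : μ = c ^ 2 • μ := by
    rw [Measure.map_map continuous_inv.measurable continuous_inv.measurable] at hcc
    simpa only [inv_involutive, Function.Involutive.comp_self, Measure.map_id] using hcc
  have K : TopologicalSpace.PositiveCompacts G := Classical.arbitrary _
  have h₁ : c ^ 2 * μ K = 1 ^ 2 * μ K := by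
    conv_rhs => rw [μeq]
    simp
  have h₂ : c ^ 2 = 1 ^ 2 :=
    (ENNReal.mul_left_inj (Measure.measure_pos_of_nonempty_interior _ K.interior_nonempty).ne'
          K.isCompact.measure_lt_top.ne).1 h₁
  have h₃ : c = 1 := (ENNReal.pow_right_strictMono two_ne_zero).injective h₂
  rw [hc, h₃, one_smul]

end Unimodular

/-! ### Formal degree, and continuity of moduli of coefficients -/

namespace ProjectiveRep

variable {G H : Type*} [Group G] [TopologicalSpace G] [IsTopologicalGroup G]
  [LocallyCompactSpace G] [SecondCountableTopology G] [MeasurableSpace G] [BorelSpace G]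
  [NormedAddCommGroup H] [InnerProductSpace ℂ H] (π : ProjectiveRep G H) (μ : Measure G)

theorem sqIntegrable_symm [μ.IsHaarMeasure] [μ.IsMulRightInvariant] {g f : H}
    (h : f ∈ π.sqIntegrable μ g) : g ∈ π.sqIntegrable μ f := by
  have := isInvInvariant_of_isMulRightInvariant μ
  rw [mem_sqIntegrable] at h ⊢
  refine (h.comp_measurePreserving (Measure.measurePreserving_inv μ)).congr_norm
    (π.stronglyMeasurable_coeff _ _).aestronglyMeasurable ?_
  exact Eventually.of_forall fun x => π.norm_coeff_inv _ _ _

theorem integral_norm_coeff_symm [μ.IsHaarMeasure] [μ.IsMulRightInvariant] (g f : H) :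
    ∫ x, ‖π.coeff g f x‖ ^ 2 ∂μ = ∫ x, ‖π.coeff f g x‖ ^ 2 ∂μ := by
  have := isInvInvariant_of_isMulRightInvariant μ
  rw [← integral_inv_eq_self]
  simp only [norm_coeff_inv]

/-- **Orthogonality relations** for square-integrable projective representations of unimodular
groups, and uniqueness of the formal degree. -/
theorem IsDiscreteSeries.existsUnique_isFormalDegree [CompleteSpace H]
    [TopologicalSpace.SeparableSpace H] [μ.IsHaarMeasure] [μ.IsMulRightInvariant]
    {π : ProjectiveRep G H} (hπ : π.IsDiscreteSeries μ) : ∃! d : ℝ, π.IsFormalDegree μ d := by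
  obtain ⟨hirr, g₀, hg₀, hint⟩ := hπ
  have hmem₀ : g₀ ∈ π.sqIntegrable μ g₀ :=
    (memLp_two_iff_integrable_sq_norm
      (π.stronglyMeasurable_coeff _ _).aestronglyMeasurable).2 hint
  obtain ⟨c₀, hc₀⟩ := π.exists_integral_coeff_eq_of_window μ hirr hg₀ hmem₀
  have hwin : ∀ g, ∃ c : ℝ, ∀ f, f ∈ π.sqIntegrable μ g ∧
      ∀ f', ∫ x, (starRingEnd ℂ) (π.coeff g f' x) * π.coeff g f x ∂μ = c * inner ℂ f' f :=
    fun g => π.exists_integral_coeff_eq_of_window μ hirr hg₀ (π.sqIntegrable_symm μ (hc₀ g).1)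
  choose c hc using hwin
  have hmem : ∀ g f, MemLp (π.coeff g f) 2 μ := fun g f => (hc g f).1
  have hnorm : ∀ g f, ∫ x, ‖π.coeff g f x‖ ^ 2 ∂μ = c g * ‖f‖ ^ 2 := by
    intro g f
    have h₁ := (hc g f).2 f
    rw [integral_conj_mul_coeff_self, inner_self_eq_norm_sq_to_K] at h₁
    apply Complex.ofReal_injective
    rw [h₁]
    push_cast
    rfl
  have hn₀ : ‖g₀‖ ^ 2 ≠ 0 := by simpa using hg₀
  -- `c g * ‖f‖ ^ 2` is symmetric in `f` and `g`, so `c g` is proportional to `‖g‖ ^ 2`.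
  obtain ⟨C, hC⟩ : ∃ C : ℝ, ∀ g, c g = C * ‖g‖ ^ 2 := by
    refine ⟨c g₀ / ‖g₀‖ ^ 2, fun g => ?_⟩
    have h₁ := hnorm g g₀
    rw [integral_norm_coeff_symm, hnorm] at h₁
    field_simp
    exact h₁.symm
  have hC0 : 0 < C := by
    have hnn : 0 ≤ C * ‖g₀‖ ^ 2 * ‖g₀‖ ^ 2 := by
      rw [← hC, ← hnorm]
      exact integral_nonneg fun x => by positivity
    have hnn' : 0 ≤ C := by
      by_contra! h
      have : 0 < ‖g₀‖ ^ 2 := by positivity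
      nlinarith [mul_pos this this]
    refine lt_of_le_of_ne hnn' fun h0 => ?_
    -- If `C = 0`, every coefficient against `g₀` vanishes almost everywhere. Separability gives one
    -- `x` that works for a dense set of `f`, hence for `f = π x g₀`, a contradiction.
    have hzero : ∀ f, ∀ᵐ x ∂μ, π.coeff g₀ f x = 0 := by
      intro f
      have h₁ := hnorm g₀ f
      rw [hC, ← h0, zero_mul, zero_mul, integral_eq_zero_iff_of_nonneg (fun x => by positivity)
        ((memLp_two_iff_integrable_sq_norm (hmem g₀ f).1).1 (hmem g₀ f))] at h₁
      filter_upwards [h₁] with x hx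
      simpa using hx
    obtain ⟨s, hs, hd⟩ := TopologicalSpace.exists_countable_dense H
    have := hs.to_subtype
    obtain ⟨x, hx⟩ := (ae_all_iff.2 fun f : s => hzero f).exists
    have hclosed : IsClosed {f : H | π.coeff g₀ f x = 0} :=
      isClosed_eq (continuous_const.inner continuous_id) continuous_const
    have hall := hclosed.closure_subset_iff.2 (fun f hf => hx ⟨f, hf⟩ : s ⊆ _)
    rw [hd.closure_eq] at hall
    have h₂ : inner ℂ (π.op x g₀) (π.op x g₀) = 0 := hall (Set.mem_univ _)
    rw [inner_self_eq_zero, LinearIsometryEquiv.map_eq_zero_iff] at h₂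
    exact hg₀ h₂
  have hintg : ∀ f₁ f₂ g₁ g₂, Integrable
      (fun x => π.coeff g₁ f₁ x * (starRingEnd ℂ) (π.coeff g₂ f₂ x)) μ := fun f₁ f₂ g₁ g₂ =>
    (hmem g₁ f₁).integrable_mul ((hmem g₂ f₂).congr_norm
      (continuous_star.comp_stronglyMeasurable (π.stronglyMeasurable_coeff g₂ f₂)).aestronglyMeasurable
      (Eventually.of_forall fun x => (RCLike.norm_conj _).symm))
  have hdeg : π.IsFormalDegree μ C⁻¹ := by
    refine ⟨inv_pos.2 hC0, fun f₁ f₂ g₁ g₂ => ⟨hintg _ _ _ _, ?_⟩⟩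
    -- For fixed `f₁`, `f₂` both sides are sesquilinear in the windows and agree when the windows
    -- are equal; polarization does the rest.
    let B : H →ₗ[ℂ] H →ₗ⋆[ℂ] ℂ := LinearMap.mk₂'ₛₗ (RingHom.id ℂ) (starRingEnd ℂ)
      (fun u v => ∫ x, π.coeff v f₁ x * (starRingEnd ℂ) (π.coeff u f₂ x) ∂μ)
      (fun u u' v => by
        rw [← integral_add (hintg _ _ _ _) (hintg _ _ _ _)]
        simp only [coeff_add_left, map_add, mul_add])
      (fun a u v => by
        simp only [coeff_smul_left, map_mul, RCLike.conj_conj, RingHom.id_apply, smul_eq_mul,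
          mul_left_comm _ a, integral_const_mul])
      (fun u v v' => by
        rw [← integral_add (hintg _ _ _ _) (hintg _ _ _ _)]
        simp only [coeff_add_left, add_mul])
      (fun a u v => by
        simp only [coeff_smul_left, mul_assoc, smul_eq_mul, integral_const_mul])
    let S : H →ₗ[ℂ] H →ₗ⋆[ℂ] ℂ := LinearMap.mk₂'ₛₗ (RingHom.id ℂ) (starRingEnd ℂ)
      (fun u v => C * inner ℂ f₂ f₁ * inner ℂ v u)
      (fun u u' v => by rw [inner_add_right, mul_add])
      (fun a u v => by rw [inner_smul_right, mul_left_comm]; rfl)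
      (fun u v v' => by rw [inner_add_left, mul_add])
      (fun a u v => by rw [inner_smul_left, mul_left_comm]; rfl)
    have hBS := sesquilinear_eq_of_diagonal_eq B S (fun v => by
      simp only [B, S, LinearMap.mk₂'ₛₗ_apply]
      have h₁ := (hc v f₁).2 f₂
      rw [hC] at h₁
      simp only [mul_comm (π.coeff v f₁ _)]
      rw [h₁, inner_self_eq_norm_sq_to_K]
      push_cast
      simp only [Complex.coe_algebraMap]
      ring) g₂ g₁
    simp only [B, S, LinearMap.mk₂'ₛₗ_apply] at hBS
    rw [hBS, inner_conj_symm]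
    simp
  refine ⟨C⁻¹, hdeg, fun d hd => ?_⟩
  have h₁ := (hd.2 g₀ g₀ g₀ g₀).2
  rw [(hdeg.2 g₀ g₀ g₀ g₀).2] at h₁
  have h₂ : inner ℂ g₀ g₀ ≠ 0 := inner_self_ne_zero.2 hg₀
  rw [inner_conj_symm] at h₁
  have h₃ := mul_right_cancel₀ h₂ (mul_right_cancel₀ h₂ h₁)
  have h₄ := inv_injective h₃
  exact_mod_cast h₄.symm

/-- The modulus of a coefficient is close to its value at the identity near the identity. -/
theorem tendsto_norm_coeff_self_one [TopologicalSpace.SeparableSpace H] [μ.IsHaarMeasure] (g : H) :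
    Tendsto (fun u => ‖π.coeff g g u‖) (𝓝 1) (𝓝 (‖g‖ ^ 2)) := by
  borelize H
  have hup : ∀ u, ‖π.coeff g g u‖ ≤ ‖g‖ ^ 2 := fun u => by
    simpa [sq] using π.norm_coeff_le g g u
  rw [Metric.tendsto_nhds]
  intro ε hε
  obtain ⟨r, hr, hrε⟩ : ∃ r : ℝ, 0 < r ∧ 2 * r ^ 2 < ε := by
    refine ⟨Real.sqrt (ε / 4), Real.sqrt_pos.2 (by positivity), ?_⟩
    rw [Real.sq_sqrt (by positivity)]
    linarith
  -- Steinhaus argument: by separability some ball of radius `r` has a `ψ`-preimage `E` of positive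
  -- measure, and `E / E` is a neighborhood of `1`. For `x, y ∈ E` the vectors `ψ x`, `ψ y` are
  -- within `2 * r`, and their inner product has the modulus of the coefficient at `x / y`.
  let ψ : G → H := fun x => π.op x⁻¹ g
  have hψ : Measurable ψ := (π.stronglyMeasurable g).measurable.comp measurable_inv
  obtain ⟨v, hv⟩ : ∃ v : H, 0 < μ (ψ ⁻¹' Metric.ball v r) := by
    obtain ⟨s, hs, hd⟩ := TopologicalSpace.exists_countable_dense H
    by_contra! h
    have hcov : (Set.univ : Set G) ⊆ ⋃ v ∈ s, ψ ⁻¹' Metric.ball v r := fun x _ => by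
      obtain ⟨v, hv, hvr⟩ := Metric.dense_iff.1 hd (ψ x) r hr
      exact Set.mem_biUnion hvr (by simpa [dist_comm] using hv)
    have := measure_mono_null hcov
      ((measure_biUnion_null_iff hs).2 fun v _ => le_antisymm (h v) zero_le)
    exact (isOpen_univ.measure_pos μ Set.univ_nonempty).ne' this
  filter_upwards [Measure.div_mem_nhds_one_of_haar_pos μ _
    (hψ measurableSet_ball) hv] with u hu
  obtain ⟨x, hx, y, hy, rfl⟩ := hu
  have hdist : ‖ψ y - ψ x‖ < 2 * r := by
    rw [← dist_eq_norm]
    calc dist (ψ y) (ψ x) ≤ dist (ψ y) v + dist (ψ x) v := dist_triangle_right _ _ _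
      _ < 2 * r := by linarith [Metric.mem_ball.1 hx, Metric.mem_ball.1 hy]
  have hV : ‖inner ℂ (ψ y) (ψ x)‖ = ‖π.coeff g g (x / y)‖ := by
    have h₁ := π.norm_coeff_op g g x⁻¹ y⁻¹
    rw [inv_inv, ← div_eq_mul_inv] at h₁
    exact h₁
  have hsq : ‖ψ y - ψ x‖ ^ 2 = 2 * ‖g‖ ^ 2 - 2 * (inner ℂ (ψ y) (ψ x)).re := by
    rw [norm_sub_sq (𝕜 := ℂ)]
    simp only [ψ, LinearIsometryEquiv.norm_map]
    change _ - 2 * (inner ℂ _ _).re + _ = _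
    ring
  have hre := (Complex.re_le_norm (inner ℂ (ψ y) (ψ x)))
  rw [hV] at hre
  have hlt : ‖ψ y - ψ x‖ ^ 2 < (2 * r) ^ 2 := by gcongr
  rw [Real.dist_eq, abs_sub_comm, abs_of_nonneg (sub_nonneg.2 (hup _))]
  nlinarith

/-- Up to a phase, `π y g` is close to `π x g` when `x⁻¹ * y` is near `1`. The phase is uncontrolled
because the cocycle is not assumed continuous, hence only the modulus is treated. -/
theorem continuous_norm_coeff [TopologicalSpace.SeparableSpace H] [μ.IsHaarMeasure] (g f : H) :
    Continuous fun x => ‖π.coeff g f x‖ := by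
  rw [continuous_iff_continuousAt]
  intro x
  have h₀ : Tendsto (fun y => Real.sqrt (2 * (‖g‖ ^ 2 - ‖π.coeff g g (x⁻¹ * y)‖)) * ‖f‖) (𝓝 x)
      (𝓝 0) := by
    have h₁ : Tendsto (fun y => x⁻¹ * y) (𝓝 x) (𝓝 1) := by
      have := (continuous_const_mul x⁻¹).tendsto x
      rwa [inv_mul_cancel] at this
    have h₂ := ((((tendsto_norm_coeff_self_one π μ g).comp h₁).const_sub (‖g‖ ^ 2)).const_mul
      2).sqrt.mul_const ‖f‖
    simpa using h₂
  refine tendsto_iff_dist_tendsto_zero.2 (squeeze_zero (fun _ => dist_nonneg) (fun y => ?_) h₀)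
  obtain ⟨t, ht, h⟩ := π.exists_norm_op_sub_smul_le g (x⁻¹ * y)
  rw [← h, Real.sqrt_sq (norm_nonneg _), Real.dist_eq]
  have e₁ : ‖π.coeff g f y‖ = ‖inner ℂ (π.op x (π.op (x⁻¹ * y) g)) f‖ := by
    rw [op_op, mul_inv_cancel_left, inner_smul_left, norm_mul, RCLike.norm_conj, Circle.norm_coe,
      one_mul]
    rfl
  have e₂ : ‖π.coeff g f x‖ = ‖inner ℂ (π.op x (t • g)) f‖ := by
    rw [map_smul, inner_smul_left, norm_mul, RCLike.norm_conj, ht, one_mul]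
    rfl
  beta_reduce
  rw [e₁, e₂]
  refine (abs_norm_sub_norm_le _ _).trans ?_
  rw [← inner_sub_left, ← map_sub]
  exact (norm_inner_le_norm _ _).trans (by rw [LinearIsometryEquiv.norm_map])

end ProjectiveRep

/-- The family `e` is a Bessel sequence with bound `B`. -/
def IsBessel {H ι : Type*} [NormedAddCommGroup H] [InnerProductSpace ℂ H] (e : ι → H)
    (B : ℝ≥0∞) : Prop :=
  ∀ f : H, ∑' i, ‖inner ℂ (e i) f‖ₑ ^ 2 ≤ B * ‖f‖ₑ ^ 2

theorem IsBessel.enorm_sq_le {H ι : Type*} [NormedAddCommGroup H] [InnerProductSpace ℂ H]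
    {e : ι → H} {B : ℝ≥0∞} (h : IsBessel e B) (i : ι) : ‖e i‖ₑ ^ 2 ≤ B := by
  by_cases h0 : e i = 0
  · simp [h0]
  have h₁ := (ENNReal.le_tsum i).trans (h (e i))
  have h₂ : ‖inner ℂ (e i) (e i)‖ₑ = ‖e i‖ₑ ^ 2 := by
    rw [← ofReal_norm, ← ofReal_norm, ← ENNReal.ofReal_pow (norm_nonneg _),
      inner_self_eq_norm_sq_to_K]
    simp
  rw [h₂, sq (‖e i‖ₑ ^ 2)] at h₁
  refine (ENNReal.mul_le_mul_iff_left ?_ ?_).1 h₁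
  · simpa using h0
  · simp

theorem tsum_indicator_one {α : Type*} (Λ A : Set α) :
    ∑' l : Λ, A.indicator (1 : α → ℝ≥0∞) l = ((Λ ∩ A).encard : ℝ≥0∞) := by
  rw [tsum_subtype Λ (A.indicator 1), Set.indicator_indicator, ← tsum_subtype]
  exact ENNReal.tsum_set_one _

theorem encard_le_of_forall_finset {α : Type*} {s : Set α} {N : ℕ}
    (h : ∀ t : Finset α, (t : Set α) ⊆ s → t.card ≤ N) : s.encard ≤ N := by
  by_contra! hlt
  obtain ⟨t, hts, ht⟩ := Set.exists_subset_encard_eq (k := ((N + 1 : ℕ) : ℕ∞)) (s := s)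
    (by push_cast; exact Order.add_one_le_of_lt hlt)
  have hfin := Set.finite_of_encard_eq_coe ht
  have h₁ := h hfin.toFinset (by simpa using hts)
  rw [hfin.encard_eq_coe_toFinset_card] at ht
  have : hfin.toFinset.card = N + 1 := by exact_mod_cast ht
  omega

/-- The weight `t` will be small: the non-localized factor receives `t`, and the tail of the
localized factor is chosen afterwards to beat `t⁻¹`. -/
theorem ennreal_mul_le_inv_mul_sq_add_mul_sq (u v : ℝ≥0∞) {t : ℝ≥0∞} (ht : t ≠ 0) (ht' : t ≠ ∞) :
    u * v ≤ t⁻¹ * u ^ 2 + t * v ^ 2 := by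
  rcases le_total u (t * v) with h | h
  · calc u * v ≤ t * v * v := by gcongr
      _ = t * v ^ 2 := by ring
      _ ≤ _ := le_add_self
  · calc u * v = u * (t⁻¹ * (t * v)) := by rw [← mul_assoc t⁻¹, ENNReal.inv_mul_cancel ht ht', one_mul]
      _ ≤ u * (t⁻¹ * u) := by gcongr
      _ = t⁻¹ * u ^ 2 := by ring
      _ ≤ _ := le_self_add

/-! ### Relatively separated sets and sampling by local maximal functions -/

section Separated

/-- `Λ` has at most `N` points in each left translate of `U`. -/
def IsSeparated {G : Type*} [Group G] (Λ U : Set G) (N : ℕ) : Prop :=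
  ∀ x : G, (Λ ∩ x • U).encard ≤ N

theorem IsSeparated.mono {G : Type*} [Group G] {Λ U V : Set G} {N : ℕ} (h : IsSeparated Λ U N) (hV : V ⊆ U) :
    IsSeparated Λ V N := fun x =>
  (Set.encard_le_encard (Set.inter_subset_inter_right _ (Set.smul_set_mono hV))).trans (h x)

variable {G : Type*} [Group G] [TopologicalSpace G] [IsTopologicalGroup G]

theorem IsSeparated.countable [SecondCountableTopology G] {Λ U : Set G} {N : ℕ}
    (h : IsSeparated Λ U N) (hU : U ∈ 𝓝 (1 : G)) : Λ.Countable := by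
  obtain ⟨s, hs, hcov⟩ := TopologicalSpace.countable_cover_nhds
    (f := fun x : G => x • U) (fun x => by simpa using smul_mem_nhds_smul x hU)
  have : Λ ⊆ ⋃ x ∈ s, Λ ∩ x • U := by
    rw [← Set.inter_iUnion₂, hcov, Set.inter_univ]
  refine (hs.biUnion fun x _ => ?_).mono this
  exact (Set.finite_of_encard_le_coe (h x)).countable

/-- Sums over a separated set are controlled by integrals of a local majorant. -/
theorem IsSeparated.tsum_mul_measure_le [SecondCountableTopology G] [MeasurableSpace G]
    [BorelSpace G] {Λ U : Set G} {N : ℕ} (h : IsSeparated Λ U N) (hU : IsOpen U) (h1 : (1 : G) ∈ U)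
    (hsymm : U⁻¹ = U) (μ : Measure G) [μ.IsMulLeftInvariant] (S : Set G) {F M : G → ℝ≥0∞}
    (hM : Measurable M) (hFM : ∀ l, ∀ u ∈ U, F l ≤ M (l * u)) :
    (∑' l : Λ, S.indicator F l) * μ U ≤ N * ∫⁻ y in S * U, M y ∂μ := by
  have := (h.countable (hU.mem_nhds h1)).to_subtype
  have hSU : MeasurableSet (S * U) := hU.mul_left.measurableSet
  calc (∑' l : Λ, S.indicator F l) * μ U = ∑' l : Λ, S.indicator F l * μ ((l : G) • U) := by
        simp only [measure_smul, ENNReal.tsum_mul_right]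
    _ ≤ ∑' l : Λ, ∫⁻ y in S * U, ((l : G) • U).indicator M y ∂μ := by
        refine ENNReal.tsum_le_tsum fun l => ?_
        by_cases hl : (l : G) ∈ S
        · rw [Set.indicator_of_mem hl,
            lintegral_indicator (hU.smul (l : G)).measurableSet,
            Measure.restrict_restrict (hU.smul (l : G)).measurableSet, Set.inter_eq_left.2
              (by rintro _ ⟨u, hu, rfl⟩; exact Set.mul_mem_mul hl hu), ← setLIntegral_const]
          refine setLIntegral_mono hM ?_
          rintro _ ⟨u, hu, rfl⟩
          exact hFM _ u hu
        · simp [hl]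
    _ = ∫⁻ y in S * U, ∑' l : Λ, ((l : G) • U).indicator M y ∂μ := by
        rw [lintegral_tsum]
        exact fun l => (hM.indicator (hU.smul (l : G)).measurableSet).aemeasurable
    _ ≤ ∫⁻ y in S * U, N * M y ∂μ := by
        refine lintegral_mono fun y => ?_
        -- As `U` is symmetric, the `l` with `y ∈ l U` are the points of `Λ` in `y U`, at most `N`
        -- of them.
        have h₁ : ∀ l : Λ, ((l : G) • U).indicator M y = (y • U).indicator 1 (l : G) * M y := by
          intro l
          have : y ∈ (l : G) • U ↔ (l : G) ∈ y • U := by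
            rw [Set.mem_smul_set_iff_inv_smul_mem, Set.mem_smul_set_iff_inv_smul_mem,
              smul_eq_mul, smul_eq_mul, ← Set.inv_mem_inv, hsymm, mul_inv_rev, inv_inv]
          by_cases hy : y ∈ (l : G) • U
          · simp [hy, this.1 hy]
          · simp [hy, mt this.2 hy]
        simp only [h₁, ENNReal.tsum_mul_right, tsum_indicator_one]
        gcongr
        exact_mod_cast h y
    _ = N * ∫⁻ y in S * U, M y ∂μ := lintegral_const_mul _ hM

theorem IsSeparated.encard_mul_measure_le [SecondCountableTopology G] [MeasurableSpace G]
    [BorelSpace G] {Λ U : Set G} {N : ℕ} (h : IsSeparated Λ U N) (hU : IsOpen U) (h1 : (1 : G) ∈ U)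
    (hsymm : U⁻¹ = U) (μ : Measure G) [μ.IsMulLeftInvariant] (S : Set G) :
    ((Λ ∩ S).encard : ℝ≥0∞) * μ U ≤ N * μ (S * U) := by
  have := h.tsum_mul_measure_le hU h1 hsymm μ S (F := 1) (M := 1) measurable_one
    (fun _ _ _ => le_rfl)
  simpa [tsum_indicator_one] using this

theorem IsSeparated.finite_inter_isCompact {Λ U K : Set G} {N : ℕ}
    (h : IsSeparated Λ U N) (hU : U ∈ 𝓝 (1 : G)) (hK : IsCompact K) :
    (Λ ∩ K).Finite := by
  obtain ⟨t, -, ht⟩ := hK.elim_nhds_subcover (fun x => x • U)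
    (fun x _ => by simpa using smul_mem_nhds_smul x hU)
  refine (t.finite_toSet.biUnion fun x _ => Set.finite_of_encard_le_coe (h x)).subset ?_
  rintro y ⟨hy, hyK⟩
  obtain ⟨x, hx, hxy⟩ := Set.mem_iUnion₂.1 (ht hyK)
  exact Set.mem_biUnion hx ⟨hy, hxy⟩

end Separated

section LocalMaximal

theorem enorm_le_localMaximal {G : Type*} [Group G] {Q : Set G} (hQ : Q⁻¹ = Q) (F : G → ℂ) (x : G) {u : G} (hu : u ∈ Q) :
    ‖F x‖ₑ ≤ localMaximal Q F (x * u) := by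
  have hu' : u⁻¹ ∈ Q := by rwa [← hQ, Set.inv_mem_inv]
  have h := le_iSup₂ (f := fun z (_ : z ∈ Q) => ‖F (x * u * z)‖ₑ) u⁻¹ hu'
  rw [mul_inv_cancel_right] at h
  exact h

variable {G : Type*} [Group G] [TopologicalSpace G] [IsTopologicalGroup G]

/-- A supremum of continuous functions is lower semicontinuous, so no regularity of `Q` is needed.
-/
theorem measurable_localMaximal [MeasurableSpace G] [BorelSpace G] {F : G → ℂ}
    (hF : Continuous fun x => ‖F x‖) (Q : Set G) : Measurable (localMaximal Q F) := by
  have hF' : Continuous fun x => ‖F x‖ₑ := by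
    simp only [← ofReal_norm]
    exact ENNReal.continuous_ofReal.comp hF
  refine LowerSemicontinuous.measurable ?_
  exact lowerSemicontinuous_biSup fun z _ =>
    (hF'.comp (continuous_mul_const z)).lowerSemicontinuous

end LocalMaximal

/-- The orbit of a Bessel family generated by a nonzero vector is relatively separated. -/
theorem exists_isSeparated_of_isBessel {G H : Type*} [Group G] [TopologicalSpace G]
    [IsTopologicalGroup G] [LocallyCompactSpace G] [SecondCountableTopology G] [MeasurableSpace G]
    [BorelSpace G] [NormedAddCommGroup H] [InnerProductSpace ℂ H]
    [TopologicalSpace.SeparableSpace H] (π : ProjectiveRep G H) (μ : Measure G) [μ.IsHaarMeasure]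
    {Λ : Set G} {g : H} (hg : g ≠ 0) {B : ℝ≥0∞} (hB : B ≠ ∞)
    (h : IsBessel (fun l : Λ => π.op l g) B) :
    ∃ U : Set G, U ∈ 𝓝 (1 : G) ∧ ∃ N, IsSeparated Λ U N := by
  have hg' : 0 < ‖g‖ := norm_pos_iff.2 hg
  let c : ℝ≥0∞ := ENNReal.ofReal (‖g‖ ^ 2 / 2)
  have hc0 : c ≠ 0 := by simp [c]; positivity
  have hctop : c ≠ ∞ := ENNReal.ofReal_ne_top
  -- Each `l ∈ x U` contributes at least `c ^ 2` to the Bessel sum of `π x g`, which bounds the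
  -- number of such `l` independently of `x`.
  refine ⟨{u | ‖g‖ ^ 2 / 2 < ‖π.coeff g g u‖}, ?_, ?_⟩
  · have := π.tendsto_norm_coeff_self_one μ g
    exact this.eventually_const_lt (by nlinarith [sq_pos_of_pos hg'])
  obtain ⟨N, hN⟩ := ENNReal.exists_nat_gt (r := B * ‖g‖ₑ ^ 2 / c ^ 2)
    (ENNReal.div_ne_top (ENNReal.mul_ne_top hB (by simp)) (by simpa using hc0))
  refine ⟨N, fun x => encard_le_of_forall_finset fun t ht => ?_⟩
  have hBx := h (π.op x g)
  have hterm : ∀ l ∈ t, c ^ 2 ≤ ‖inner ℂ (π.op l g) (π.op x g)‖ₑ ^ 2 := by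
    intro l hl
    gcongr
    obtain ⟨u, hu, rfl⟩ := (ht hl).2
    have h₁ : ‖inner ℂ (π.op (x • u) g) (π.op x g)‖ = ‖π.coeff g g u‖ := by
      have := π.norm_coeff_op g g x (x • u)
      rwa [smul_eq_mul, inv_mul_cancel_left] at this
    rw [← ofReal_norm, h₁]
    exact ENNReal.ofReal_le_ofReal hu.le
  have hsum : (t.card : ℝ≥0∞) * c ^ 2 ≤ B * ‖g‖ₑ ^ 2 := by
    have hgx : ‖π.op x g‖ₑ = ‖g‖ₑ := by simp [← ofReal_norm]
    rw [hgx, tsum_subtype Λ (fun l => ‖inner ℂ (π.op l g) (π.op x g)‖ₑ ^ 2)] at hBx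
    refine le_trans ?_ ((ENNReal.sum_le_tsum t).trans hBx)
    rw [← nsmul_eq_mul]
    refine Finset.card_nsmul_le_sum _ _ _ fun l hl => ?_
    rw [Set.indicator_of_mem (ht hl).1]
    exact hterm l hl
  have hle : (t.card : ℝ≥0∞) < N :=
    lt_of_le_of_lt ((ENNReal.le_div_iff_mul_le (by simp [hc0]) (by simp [hctop])).2 hsum) hN
  exact_mod_cast hle.le

theorem exists_isCompact_setLIntegral_compl_lt {G : Type*} [TopologicalSpace G] [T2Space G]
    [LocallyCompactSpace G] [SecondCountableTopology G] [MeasurableSpace G] [BorelSpace G]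
    (μ : Measure G) {M : G → ℝ≥0∞} (hM : ∫⁻ x, M x ∂μ ≠ ∞) {ε : ℝ≥0∞} (hε : ε ≠ 0) :
    ∃ L : Set G, IsCompact L ∧ ∫⁻ x in Lᶜ, M x ∂μ < ε := by
  let E := CompactExhaustion.choice G
  have hmeas : ∀ n, MeasurableSet (E n)ᶜ := fun n => (E.isCompact n).measurableSet.compl
  have hanti : Antitone fun n => (E n)ᶜ := fun m n hmn => Set.compl_subset_compl.2 (E.subset hmn)
  have h := tendsto_measure_iInter_atTop (μ := μ.withDensity M)
    (fun n => (hmeas n).nullMeasurableSet) hanti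
    ⟨0, ((measure_mono (Set.subset_univ _)).trans_lt
      (by rw [withDensity_apply _ MeasurableSet.univ]; simpa using hM.lt_top)).ne⟩
  rw [← Set.compl_iUnion, E.iUnion_eq, Set.compl_univ, measure_empty] at h
  obtain ⟨n, hn⟩ := (h.eventually_lt_const (pos_iff_ne_zero.2 hε)).exists
  exact ⟨E n, E.isCompact n, by rwa [← withDensity_apply _ (hmeas n)]⟩

/-! ### Kernel terms and their localization -/

namespace ProjectiveRep

theorem IsFormalDegree.lintegral_enorm_coeff_sq {G H : Type*} [Group G] [MeasurableSpace G]
    [NormedAddCommGroup H] [InnerProductSpace ℂ H] {π : ProjectiveRep G H} {μ : Measure G} {d : ℝ}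
    (hd : π.IsFormalDegree μ d) (g f : H) :
    ∫⁻ x, ‖π.coeff g f x‖ₑ ^ 2 ∂μ = ENNReal.ofReal d⁻¹ * ‖g‖ₑ ^ 2 * ‖f‖ₑ ^ 2 := by
  obtain ⟨hint, heq⟩ := hd.2 f f g g
  have h₁ : ∀ x, π.coeff g f x * (starRingEnd ℂ) (π.coeff g f x) =
      ((‖π.coeff g f x‖ ^ 2 : ℝ) : ℂ) := fun x => by
    rw [RCLike.mul_conj]
    norm_cast
  simp only [h₁] at hint heq
  rw [integral_complex_ofReal, inner_conj_symm, inner_self_eq_norm_sq_to_K,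
    inner_self_eq_norm_sq_to_K] at heq
  have heq' : ∫ x, ‖π.coeff g f x‖ ^ 2 ∂μ = d⁻¹ * ‖f‖ ^ 2 * ‖g‖ ^ 2 := by
    apply Complex.ofReal_injective
    rw [heq]
    push_cast
    rfl
  have hint' : Integrable (fun x => ‖π.coeff g f x‖ ^ 2) μ := by
    simpa using hint.norm
  have h₂ : ∀ x, ‖π.coeff g f x‖ₑ ^ 2 = ENNReal.ofReal (‖π.coeff g f x‖ ^ 2) := fun x => by
    rw [ENNReal.ofReal_pow (norm_nonneg _), ofReal_norm]
  simp only [h₂]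
  rw [← ofReal_integral_eq_lintegral_ofReal hint' (Eventually.of_forall fun x => by positivity),
    heq', mul_right_comm, ENNReal.ofReal_mul (by have := hd.1; positivity),
    ENNReal.ofReal_mul (by have := hd.1; positivity), ENNReal.ofReal_pow (norm_nonneg _),
    ENNReal.ofReal_pow (norm_nonneg _), ofReal_norm, ofReal_norm]

variable {G H : Type*} [Group G] [MeasurableSpace G] [NormedAddCommGroup H]
  [InnerProductSpace ℂ H] (π : ProjectiveRep G H)

/-- The summand of the kernel `∑ ⟨π l g, π x g⟩ ⟨π x g, h l⟩` as a function on `G`. -/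
noncomputable def kernelTerm {Λ : Set G} (g : H) (h : Λ → H) (l : Λ) (x : G) : ℂ :=
  π.coeff g (π.op l g) x * (starRingEnd ℂ) (π.coeff g (h l) x)

variable {Λ : Set G} (g : H) (h : Λ → H)

theorem enorm_kernelTerm (l : Λ) (x : G) : ‖π.kernelTerm g h l x‖ₑ =
    ‖π.coeff g (π.op l g) x‖ₑ * ‖π.coeff g (h l) x‖ₑ := by
  rw [kernelTerm, enorm_mul, ← ofReal_norm ((starRingEnd ℂ) _), RCLike.norm_conj, ofReal_norm]

theorem measurable_kernelTerm (l : Λ) : Measurable (π.kernelTerm g h l) :=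
  (π.stronglyMeasurable_coeff _ _).measurable.mul
    (continuous_star.comp_stronglyMeasurable (π.stronglyMeasurable_coeff g (h l))).measurable

theorem enorm_coeff_op (f : H) (y x : G) :
    ‖π.coeff g (π.op y f) x‖ₑ = ‖π.coeff g f (y⁻¹ * x)‖ₑ := by
  rw [← ofReal_norm, norm_coeff_op, ofReal_norm]

theorem enorm_coeff_inv (f : H) (x : G) : ‖π.coeff g f x⁻¹‖ₑ = ‖π.coeff f g x‖ₑ := by
  rw [← ofReal_norm, norm_coeff_inv, ofReal_norm]

/-- Reads the coefficient as a function of the base point `y`, so that for fixed `x` sums over `Λ`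
can be compared with integrals. -/
theorem enorm_coeff_op_self (y x : G) :
    ‖π.coeff g (π.op y g) x‖ₑ = ‖π.coeff g g (x⁻¹ * y)‖ₑ := by
  rw [enorm_coeff_op, ← enorm_coeff_inv, mul_inv_rev, inv_inv]

theorem tsum_enorm_coeff_sq_le {ι : Type*} {e : ι → H} {B : ℝ≥0∞} (hB : IsBessel e B) (x : G) :
    ∑' i, ‖π.coeff g (e i) x‖ₑ ^ 2 ≤ B * ‖g‖ₑ ^ 2 := by
  have h₁ := hB (π.op x g)
  have h₂ : ‖π.op x g‖ₑ = ‖g‖ₑ := by simp [← ofReal_norm]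
  rw [h₂] at h₁
  refine le_trans (le_of_eq (tsum_congr fun i => ?_)) h₁
  rw [coeff, ← ofReal_norm, norm_inner_symm, ofReal_norm]

theorem tsum_enorm_kernelTerm_le {B B' : ℝ≥0∞} (hB : IsBessel (fun l : Λ => π.op l g) B)
    (hB' : IsBessel h B') (x : G) :
    ∑' l, ‖π.kernelTerm g h l x‖ₑ ≤ (B + B') * ‖g‖ₑ ^ 2 := by
  calc ∑' l, ‖π.kernelTerm g h l x‖ₑ
      ≤ ∑' l : Λ, (‖π.coeff g (π.op l g) x‖ₑ ^ 2 + ‖π.coeff g (h l) x‖ₑ ^ 2) := by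
        refine ENNReal.tsum_le_tsum fun l => ?_
        rw [enorm_kernelTerm]
        simpa using ennreal_mul_le_inv_mul_sq_add_mul_sq _ _ one_ne_zero ENNReal.one_ne_top
    _ ≤ B * ‖g‖ₑ ^ 2 + B' * ‖g‖ₑ ^ 2 := by
        rw [ENNReal.tsum_add]
        exact add_le_add (π.tsum_enorm_coeff_sq_le g hB x) (π.tsum_enorm_coeff_sq_le g hB' x)
    _ = _ := (add_mul _ _ _).symm

end ProjectiveRep

theorem setLIntegral_smul_comp_inv_mul {G : Type*} [Group G] [MeasurableSpace G]
    [MeasurableMul G] (μ : Measure G) [μ.IsMulLeftInvariant] (M : G → ℝ≥0∞) (x : G) {A : Set G} (hA : MeasurableSet A) :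
    ∫⁻ y in x • A, M (x⁻¹ * y) ∂μ = ∫⁻ y in A, M y ∂μ := by
  have hAx : MeasurableSet (x • A) := hA.const_smul x
  rw [← lintegral_indicator hAx, ← lintegral_indicator hA,
    ← lintegral_mul_left_eq_self (A.indicator M) x⁻¹]
  congr 1
  ext y
  by_cases hy : y ∈ x • A
  · have hy' : x⁻¹ * y ∈ A := Set.mem_smul_set_iff_inv_smul_mem.1 hy
    rw [Set.indicator_of_mem hy, Set.indicator_of_mem hy']
  · have hy' : x⁻¹ * y ∉ A := fun h => hy (Set.mem_smul_set_iff_inv_smul_mem.2 h)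
    rw [Set.indicator_of_notMem hy, Set.indicator_of_notMem hy']

section Estimate

variable {G H : Type*} [Group G] [TopologicalSpace G] [IsTopologicalGroup G] [MeasurableSpace G] [BorelSpace G]
  [NormedAddCommGroup H] [InnerProductSpace ℂ H]
  (π : ProjectiveRep G H) (μ : Measure G) [μ.IsHaarMeasure]
  {Λ : Set G} (g : H) (h : Λ → H)

open ProjectiveRep

/-- Points of `Λ` far from `x` contribute little to the kernel at `x`. -/
theorem tsum_indicator_enorm_kernelTerm_le [LocallyCompactSpace G] [SecondCountableTopology G]
    [TopologicalSpace.SeparableSpace H] {U Q L L₀ : Set G} {N : ℕ} (hs : IsSeparated Λ U N)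
    (hU : IsOpen U) (h1 : (1 : G) ∈ U) (hsymm : U⁻¹ = U) (hUtop : μ U ≠ ∞) (hUQ : U ⊆ Q) (hQ : Q⁻¹ = Q)
    (hL₀ : MeasurableSet L₀) (hL : Lᶜ * U ⊆ L₀ᶜ) {B' : ℝ≥0∞} (hB' : IsBessel h B') {t : ℝ≥0∞}
    (ht : t ≠ 0) (ht' : t ≠ ∞) (x : G) :
    ∑' l : Λ, (x • L)ᶜ.indicator 1 (l : G) * ‖π.kernelTerm g h l x‖ₑ ≤
      t⁻¹ * (N / μ U * ∫⁻ y in L₀ᶜ, localMaximal Q (π.coeff g g) y ^ 2 ∂μ) +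
        t * (B' * ‖g‖ₑ ^ 2) := by
  have hUpos : μ U ≠ 0 := (hU.measure_pos μ ⟨1, h1⟩).ne'
  have hM : Measurable fun y => localMaximal Q (π.coeff g g) y ^ 2 :=
    (measurable_localMaximal (π.continuous_norm_coeff μ g g) Q).pow_const 2
  -- Separation turns this sum into an integral of the local maximal function over a `U`-fattening
  -- of `x Lᶜ`; the margin between `L₀` and `L` keeps the fattening outside `x L₀`.
  have hsum : (∑' l : Λ, (x • L)ᶜ.indicator (fun l => ‖π.coeff g g (x⁻¹ * l)‖ₑ ^ 2) (l : G)) ≤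
      N / μ U * ∫⁻ y in L₀ᶜ, localMaximal Q (π.coeff g g) y ^ 2 ∂μ := by
    have h₁ := hs.tsum_mul_measure_le hU h1 hsymm μ (x • L)ᶜ
      (F := fun l => ‖π.coeff g g (x⁻¹ * l)‖ₑ ^ 2)
      (M := fun y => localMaximal Q (π.coeff g g) (x⁻¹ * y) ^ 2)
      (hM.comp (measurable_const_mul x⁻¹)) (fun l u hu => by
        rw [← mul_assoc]
        gcongr
        exact enorm_le_localMaximal hQ _ _ (hUQ hu))
    have h₂ : (x • L)ᶜ * U ⊆ x • L₀ᶜ := by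
      rw [← Set.smul_set_compl, smul_mul_assoc]
      exact Set.smul_set_mono hL
    have h₃ := h₁.trans (mul_le_mul_right (lintegral_mono_set h₂) _)
    rw [setLIntegral_smul_comp_inv_mul μ (fun y => localMaximal Q (π.coeff g g) y ^ 2) x
      hL₀.compl] at h₃
    rw [ENNReal.mul_comm_div, mul_div_assoc', ENNReal.le_div_iff_mul_le (Or.inl hUpos) (Or.inl hUtop)]
    exact h₃
  calc ∑' l : Λ, (x • L)ᶜ.indicator 1 (l : G) * ‖π.kernelTerm g h l x‖ₑ
      ≤ ∑' l : Λ, (t⁻¹ * (x • L)ᶜ.indicator (fun l => ‖π.coeff g g (x⁻¹ * l)‖ₑ ^ 2) (l : G) +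
          t * ‖π.coeff g (h l) x‖ₑ ^ 2) := by
        refine ENNReal.tsum_le_tsum fun l => ?_
        by_cases hl : (l : G) ∈ (x • L)ᶜ
        · rw [Set.indicator_of_mem hl, Set.indicator_of_mem hl, Pi.one_apply, one_mul,
            enorm_kernelTerm, enorm_coeff_op_self]
          exact ennreal_mul_le_inv_mul_sq_add_mul_sq _ _ ht ht'
        · rw [Set.indicator_of_notMem hl, zero_mul]
          exact zero_le
    _ = t⁻¹ * (∑' l : Λ, (x • L)ᶜ.indicator (fun l => ‖π.coeff g g (x⁻¹ * l)‖ₑ ^ 2) (l : G)) +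
          t * ∑' l : Λ, ‖π.coeff g (h l) x‖ₑ ^ 2 := by
        rw [ENNReal.tsum_add, ENNReal.tsum_mul_left, ENNReal.tsum_mul_left]
    _ ≤ _ := by
        gcongr
        exact π.tsum_enorm_coeff_sq_le g hB' x

/-- A term of the kernel is concentrated near its base point. -/
theorem setLIntegral_enorm_kernelTerm_le {Q L L₀ : Set G} (hQ1 : (1 : G) ∈ Q)
    (hQ : Q⁻¹ = Q) (hL : MeasurableSet L) (hLL : Lᶜ ⊆ L₀ᶜ) {B' : ℝ≥0∞}
    (hB' : IsBessel h B') {d : ℝ} (hd : π.IsFormalDegree μ d) {t : ℝ≥0∞}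
    (ht : t ≠ 0) (ht' : t ≠ ∞) (l : Λ) :
    ∫⁻ x in ((l : G) • L)ᶜ, ‖π.kernelTerm g h l x‖ₑ ∂μ ≤
      t⁻¹ * (∫⁻ y in L₀ᶜ, localMaximal Q (π.coeff g g) y ^ 2 ∂μ) +
        t * (ENNReal.ofReal d⁻¹ * ‖g‖ₑ ^ 2 * B') := by
  have hm : ∀ f, Measurable fun x => ‖π.coeff g f x‖ₑ ^ 2 := fun f =>
    (π.stronglyMeasurable_coeff g f).measurable.enorm.pow_const 2
  calc ∫⁻ x in ((l : G) • L)ᶜ, ‖π.kernelTerm g h l x‖ₑ ∂μ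
      ≤ ∫⁻ x in ((l : G) • L)ᶜ, (t⁻¹ * ‖π.coeff g (π.op l g) x‖ₑ ^ 2 +
          t * ‖π.coeff g (h l) x‖ₑ ^ 2) ∂μ := by
        refine lintegral_mono fun x => ?_
        rw [enorm_kernelTerm]
        exact ennreal_mul_le_inv_mul_sq_add_mul_sq _ _ ht ht'
    _ = t⁻¹ * ∫⁻ x in (l : G) • Lᶜ, ‖π.coeff g g ((l : G)⁻¹ * x)‖ₑ ^ 2 ∂μ +
          t * ∫⁻ x in ((l : G) • L)ᶜ, ‖π.coeff g (h l) x‖ₑ ^ 2 ∂μ := by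
        rw [lintegral_add_left ((hm _).const_mul _), lintegral_const_mul _ (hm _),
          lintegral_const_mul _ (hm _), Set.smul_set_compl]
        simp only [enorm_coeff_op]
    _ ≤ t⁻¹ * (∫⁻ y in L₀ᶜ, localMaximal Q (π.coeff g g) y ^ 2 ∂μ) +
          t * ∫⁻ x, ‖π.coeff g (h l) x‖ₑ ^ 2 ∂μ := by
        rw [setLIntegral_smul_comp_inv_mul μ (fun y => ‖π.coeff g g y‖ₑ ^ 2) _ hL.compl]
        refine add_le_add (mul_le_mul_right ((lintegral_mono_set hLL).trans
          (lintegral_mono fun x => ?_)) _) (mul_le_mul_right (setLIntegral_le_lintegral _ _) _)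
        gcongr
        simpa using enorm_le_localMaximal hQ (π.coeff g g) x hQ1
    _ ≤ _ := by
        rw [hd.lintegral_enorm_coeff_sq]
        gcongr
        exact hB'.enorm_sq_le l

end Estimate

/-- A point of `K * U` outside `K` lies in `Kᶜ * L` because `1 ∈ L`. -/
theorem mul_subset_union_boundary {G : Type*} [Group G] {K L U : Set G} (h1 : (1 : G) ∈ L)
    (hU : U ⊆ L) : K * U ⊆ K ∪ (K * L ∩ (Kᶜ * L)) := by
  rintro _ ⟨k, hk, u, hu, rfl⟩
  by_cases h : k * u ∈ K
  · exact Or.inl h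
  · exact Or.inr ⟨Set.mul_mem_mul hk (hU hu), _, h, 1, h1, mul_one _⟩

theorem exists_open_symm_subset_isCompact_closure {G : Type*} [Group G] [TopologicalSpace G]
    [IsTopologicalGroup G] [LocallyCompactSpace G] {V : Set G} (hV : V ∈ 𝓝 (1 : G)) :
    ∃ U : Set G, IsOpen U ∧ (1 : G) ∈ U ∧ U⁻¹ = U ∧ U ⊆ V ∧ IsCompact (closure U) := by
  obtain ⟨W, hWc, hW1⟩ := exists_compact_mem_nhds (1 : G)
  have hVW : interior (V ∩ W) ∈ 𝓝 (1 : G) := interior_mem_nhds.2 (inter_mem hV hW1)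
  refine ⟨interior (V ∩ W) ∩ (interior (V ∩ W))⁻¹,
    isOpen_interior.inter isOpen_interior.inv, ⟨mem_of_mem_nhds hVW, ?_⟩, ?_, ?_, ?_⟩
  · simpa using mem_of_mem_nhds hVW
  · rw [Set.inter_inv, inv_inv, Set.inter_comm]
  · exact Set.inter_subset_left.trans (interior_subset.trans Set.inter_subset_left)
  · exact hWc.closure_of_subset
      (Set.inter_subset_left.trans (interior_subset.trans Set.inter_subset_right))

open ProjectiveRep

/-- The error made when the terms of the kernel based in `K` are integrated over the whole group
instead of `K`, and the terms based outside `K` are dropped. -/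
noncomputable def truncationError {G H : Type*} [Group G] [MeasurableSpace G]
    [NormedAddCommGroup H] [InnerProductSpace ℂ H] (π : ProjectiveRep G H) (μ : Measure G)
    {Λ : Set G} (g : H) (h : Λ → H) (K : Set G) (l : Λ) : ℝ≥0∞ :=
  K.indicator 1 (l : G) * ∫⁻ x in Kᶜ, ‖π.kernelTerm g h l x‖ₑ ∂μ +
    Kᶜ.indicator 1 (l : G) * ∫⁻ x in K, ‖π.kernelTerm g h l x‖ₑ ∂μ

theorem lintegral_le_lintegral_inter_add {G : Type*} [MeasurableSpace G] (μ : Measure G)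
    (F : G → ℝ≥0∞) {A B C D : Set G} (hB : MeasurableSet B) (h₁ : A ∩ B ⊆ C) (h₂ : A \ B ⊆ D) :
    ∫⁻ x in A, F x ∂μ ≤ ∫⁻ x in C, F x ∂μ + ∫⁻ x in D, F x ∂μ := by
  rw [← lintegral_inter_add_sdiff F A hB]
  exact add_le_add (lintegral_mono_set h₁) (lintegral_mono_set h₂)

/-- Split at `x ∈ l L`. If `l` and `x` lie on opposite sides of `K` and `x ∈ l L`, then `x` is in
the boundary `K * L ∩ (Kᶜ * L)`; otherwise `x` is far from `l` and the kernel tails apply. -/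
theorem truncationError_le {G H : Type*} [Group G] [TopologicalSpace G] [IsTopologicalGroup G]
    [MeasurableSpace G] [BorelSpace G] [NormedAddCommGroup H] [InnerProductSpace ℂ H]
    (π : ProjectiveRep G H) (μ : Measure G) {Λ : Set G} (g : H) (h : Λ → H) {K L : Set G}
    (hL : IsClosed L) (h1 : (1 : G) ∈ L) (l : Λ) :
    truncationError π μ g h K l ≤ ∫⁻ x in K * L ∩ (Kᶜ * L), ‖π.kernelTerm g h l x‖ₑ ∂μ +
      (K.indicator 1 (l : G) * ∫⁻ x in ((l : G) • L)ᶜ, ‖π.kernelTerm g h l x‖ₑ ∂μ +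
        ∫⁻ x in K \ ((l : G) • L), ‖π.kernelTerm g h l x‖ₑ ∂μ) := by
  have hlL : MeasurableSet ((l : G) • L) := (hL.smul (l : G)).measurableSet
  by_cases hl : (l : G) ∈ K
  · have hl' : (l : G) ∉ Kᶜ := fun h => h hl
    simp only [truncationError, Set.indicator_of_mem hl, Set.indicator_of_notMem hl',
      Pi.one_apply, one_mul, zero_mul, add_zero]
    refine (lintegral_le_lintegral_inter_add μ _ hlL ?_ ?_).trans
      (add_le_add le_rfl le_self_add)
    · rintro x ⟨hx, y, hy, rfl⟩
      exact ⟨Set.mul_mem_mul hl hy, _, hx, 1, h1, mul_one _⟩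
    · exact fun x hx => hx.2
  · have hl' : (l : G) ∈ Kᶜ := hl
    simp only [truncationError, Set.indicator_of_mem hl', Set.indicator_of_notMem hl,
      Pi.one_apply, one_mul, zero_mul, zero_add]
    refine lintegral_le_lintegral_inter_add μ _ hlL ?_ le_rfl
    rintro x ⟨hx, y, hy, rfl⟩
    exact ⟨⟨_, hx, 1, h1, mul_one _⟩, Set.mul_mem_mul hl' hy⟩

section Estimate

variable {G H : Type*} [Group G] [TopologicalSpace G] [IsTopologicalGroup G] [T2Space G]
  [SecondCountableTopology G] [MeasurableSpace G] [BorelSpace G]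
  [NormedAddCommGroup H] [InnerProductSpace ℂ H]
  {π : ProjectiveRep G H} {μ : Measure G} [μ.IsHaarMeasure] {Λ : Set G} {g : H}

/-- The total truncation error over `K` is small compared with `μ K`, up to a multiple of the
measure of a boundary of `K`. -/
theorem exists_tsum_truncationError_le [LocallyCompactSpace G] [TopologicalSpace.SeparableSpace H] {d : ℝ}
    (hd : π.IsFormalDegree μ d) (hg : g ∈ π.localized μ)
    {U₀ : Set G} {N : ℕ} (hU₀ : U₀ ∈ 𝓝 (1 : G)) (hs₀ : IsSeparated Λ U₀ N) {B B' : ℝ≥0∞}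
    (hBtop : B ≠ ∞) (hBtop' : B' ≠ ∞) (hB : IsBessel (fun l : Λ => π.op l g) B) {h : Λ → H}
    (hB' : IsBessel h B') {ε : ℝ≥0∞} (hε : ε ≠ 0) :
    ∃ L : Set G, IsCompact L ∧ ∃ C : ℝ≥0∞, C ≠ ∞ ∧ ∀ K : Set G, IsCompact K →
      ∑' l, truncationError π μ g h K l ≤ ε * μ K + C * μ (K * L ∩ (Kᶜ * L)) := by
  obtain ⟨Q, hQ1, -, hQ, hQint⟩ := hg
  obtain ⟨U, hUopen, hU1, hUsymm, hUsub, hUc⟩ :=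
    exists_open_symm_subset_isCompact_closure (inter_mem hU₀ hQ1)
  have hs := hs₀.mono (hUsub.trans Set.inter_subset_left)
  have hUQ := hUsub.trans Set.inter_subset_right
  have hUpos : μ U ≠ 0 := (hUopen.measure_pos μ ⟨1, hU1⟩).ne'
  have hUtop : μ U ≠ ∞ := ((measure_mono subset_closure).trans_lt hUc.measure_lt_top).ne
  set p : ℝ≥0∞ := N / μ U with hp
  have hptop : p ≠ ∞ := ENNReal.div_ne_top (by simp) hUpos
  set C₂ : ℝ≥0∞ := ENNReal.ofReal d⁻¹ * ‖g‖ₑ ^ 2 * B' with hC₂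
  set C₃ : ℝ≥0∞ := B' * ‖g‖ₑ ^ 2 with hC₃
  have hgtop : ‖g‖ₑ ^ 2 ≠ ∞ := by simp
  have hC₂top : C₂ ≠ ∞ := by finiteness
  have hC₃top : C₃ ≠ ∞ := by finiteness
  have hε2 : ε / 2 ≠ 0 := by simpa using hε
  -- Order of choice: `t` makes the Bessel and formal degree contributions small, then the tail
  -- bound `s` is chosen against `t⁻¹`, and `L₀` last.
  obtain ⟨t, ht, htε⟩ := ENNReal.exists_nnreal_pos_mul_lt (a := p * C₂ + C₃) (by finiteness) hε2
  have ht0 : (t : ℝ≥0∞) ≠ 0 := by exact_mod_cast ht.ne'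
  have httop : (t : ℝ≥0∞) ≠ ∞ := ENNReal.coe_ne_top
  have htinv : (t : ℝ≥0∞)⁻¹ ≠ ∞ := ENNReal.inv_ne_top.2 ht0
  obtain ⟨s, hs0, hsε⟩ := ENNReal.exists_nnreal_pos_mul_lt (a := (t : ℝ≥0∞)⁻¹ * (p + p))
    (by finiteness) hε2
  obtain ⟨L₀, hL₀, hL₀s⟩ := exists_isCompact_setLIntegral_compl_lt μ hQint.ne
    (ε := (s : ℝ≥0∞)) (by exact_mod_cast hs0.ne')
  set δ := ∫⁻ y in L₀ᶜ, localMaximal Q (π.coeff g g) y ^ 2 ∂μ with hδ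
  -- The first piece gives the margin `Lᶜ * U ⊆ L₀ᶜ`, the second puts `U` and `1` in `L`;
  -- symmetrizing makes `x ∈ l L` and `l ∈ x L` equivalent.
  let L₁ := L₀ * closure U ∪ closure U
  let L := L₁ ∪ L₁⁻¹
  have hL₁ : IsCompact L₁ := (hL₀.mul hUc).union hUc
  have hL : IsCompact L := hL₁.union hL₁.inv
  have hUL : U ⊆ L := fun u hu => Or.inl (Or.inr (subset_closure hu))
  have h1L : (1 : G) ∈ L := hUL hU1
  have hLinv : L⁻¹ = L := by simp only [L, Set.union_inv, inv_inv, Set.union_comm]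
  have hLU : Lᶜ * U ⊆ L₀ᶜ := by
    rintro _ ⟨c, hc, u, hu, rfl⟩ hmem
    refine hc (Or.inl (Or.inl ⟨c * u, hmem, u⁻¹, subset_closure ?_, mul_inv_cancel_right _ _⟩))
    rwa [← hUsymm, Set.inv_mem_inv]
  have hLL : Lᶜ ⊆ L₀ᶜ := fun x hx => hLU ⟨x, hx, 1, hU1, mul_one x⟩
  set P : ℝ≥0∞ := (t : ℝ≥0∞)⁻¹ * δ + t * C₂ with hP
  set R : ℝ≥0∞ := (t : ℝ≥0∞)⁻¹ * (p * δ) + t * C₃ with hR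
  have hPtop : P ≠ ∞ := by have := hL₀s.ne_top; finiteness
  have := (hs.countable (hUopen.mem_nhds hU1)).to_subtype
  have hmeas : ∀ l, Measurable fun x => ‖π.kernelTerm g h l x‖ₑ := fun l =>
    (π.measurable_kernelTerm g h l).enorm
  refine ⟨L, hL, (B + B') * ‖g‖ₑ ^ 2 + p * P, by finiteness, fun K hK => ?_⟩
  set bd := K * L ∩ (Kᶜ * L) with hbd
  have hpart₁ : ∑' l, ∫⁻ x in bd, ‖π.kernelTerm g h l x‖ₑ ∂μ ≤ (B + B') * ‖g‖ₑ ^ 2 * μ bd := by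
    rw [← lintegral_tsum fun l => (hmeas l).aemeasurable, ← setLIntegral_const]
    exact lintegral_mono fun x => π.tsum_enorm_kernelTerm_le g h hB hB' x
  have hpart₂ : ∑' l : Λ, K.indicator 1 (l : G) *
      ∫⁻ x in ((l : G) • L)ᶜ, ‖π.kernelTerm g h l x‖ₑ ∂μ ≤ p * (μ K + μ bd) * P := by
    calc _ ≤ ∑' l : Λ, K.indicator 1 (l : G) * P := by
          refine ENNReal.tsum_le_tsum fun l => ?_
          gcongr
          exact setLIntegral_enorm_kernelTerm_le π μ g h (mem_of_mem_nhds hQ1) hQ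
            hL.measurableSet hLL hB' hd ht0 httop l
      _ = ((Λ ∩ K).encard : ℝ≥0∞) * P := by rw [ENNReal.tsum_mul_right, tsum_indicator_one]
      _ ≤ p * (μ K + μ bd) * P := by
          gcongr
          have h₁ := hs.encard_mul_measure_le hUopen hU1 hUsymm μ K
          rw [hp, ENNReal.mul_comm_div, mul_div_assoc',
            ENNReal.le_div_iff_mul_le (Or.inl hUpos) (Or.inl hUtop)]
          refine h₁.trans (mul_le_mul_right ?_ _)
          exact (measure_mono (mul_subset_union_boundary h1L hUL)).trans (measure_union_le _ _)
  -- Here infinitely many base points may contribute, so the sum over `l` is taken first at fixed `x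
  -- ∈ K`, using the symmetry of `L`.
  have hpart₃ : ∑' l : Λ, ∫⁻ x in K \ ((l : G) • L), ‖π.kernelTerm g h l x‖ₑ ∂μ ≤ R * μ K := by
    have hset : ∀ l : Λ, MeasurableSet ((l : G) • L)ᶜ := fun l =>
      (hL.smul (l : G)).measurableSet.compl
    have hind : ∀ l : Λ, (fun x => (x • L)ᶜ.indicator 1 (l : G) * ‖π.kernelTerm g h l x‖ₑ) =
        ((l : G) • L)ᶜ.indicator fun x => ‖π.kernelTerm g h l x‖ₑ := by
      intro l
      ext x
      have hiff : x ∈ (l : G) • L ↔ (l : G) ∈ x • L := by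
        rw [Set.mem_smul_set_iff_inv_smul_mem, Set.mem_smul_set_iff_inv_smul_mem,
          smul_eq_mul, smul_eq_mul, ← Set.inv_mem_inv, hLinv, mul_inv_rev, inv_inv]
      by_cases hx : x ∈ (l : G) • L
      · simp [hx, hiff.1 hx]
      · simp [hx, mt hiff.2 hx]
    have h₁ : ∀ l : Λ, ∫⁻ x in K \ ((l : G) • L), ‖π.kernelTerm g h l x‖ₑ ∂μ =
        ∫⁻ x in K, (x • L)ᶜ.indicator 1 (l : G) * ‖π.kernelTerm g h l x‖ₑ ∂μ := by
      intro l
      rw [hind, lintegral_indicator (hset l), Measure.restrict_restrict (hset l), Set.inter_comm,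
        ← Set.sdiff_eq]
    have hmeas' : ∀ l : Λ, Measurable fun x =>
        (x • L)ᶜ.indicator (1 : G → ℝ≥0∞) (l : G) * ‖π.kernelTerm g h l x‖ₑ := fun l =>
      hind l ▸ (hmeas l).indicator (hset l)
    simp only [h₁]
    rw [← lintegral_tsum fun l => (hmeas' l).aemeasurable, ← setLIntegral_const]
    exact lintegral_mono fun x => tsum_indicator_enorm_kernelTerm_le π μ g h hs hUopen hU1 hUsymm
      hUtop hUQ hQ hL₀.measurableSet hLU hB' ht0 httop x
  have hfinal : p * P + R ≤ ε := by
    calc p * P + R = (t : ℝ≥0∞)⁻¹ * (p + p) * δ + t * (p * C₂ + C₃) := by rw [hP, hR]; ring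
      _ ≤ (t : ℝ≥0∞)⁻¹ * (p + p) * s + t * (p * C₂ + C₃) := by gcongr
      _ ≤ ε / 2 + ε / 2 := by
          rw [mul_comm _ (s : ℝ≥0∞)]
          exact add_le_add hsε.le htε.le
      _ = ε := ENNReal.add_halves ε
  calc ∑' l, truncationError π μ g h K l
      ≤ ∑' l : Λ, (∫⁻ x in bd, ‖π.kernelTerm g h l x‖ₑ ∂μ +
        (K.indicator 1 (l : G) * ∫⁻ x in ((l : G) • L)ᶜ, ‖π.kernelTerm g h l x‖ₑ ∂μ +
          ∫⁻ x in K \ ((l : G) • L), ‖π.kernelTerm g h l x‖ₑ ∂μ)) :=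
        ENNReal.tsum_le_tsum fun l => truncationError_le π μ g h hL.isClosed h1L l
    _ ≤ (B + B') * ‖g‖ₑ ^ 2 * μ bd + (p * (μ K + μ bd) * P + R * μ K) := by
        rw [ENNReal.tsum_add, ENNReal.tsum_add]
        exact add_le_add hpart₁ (add_le_add hpart₂ hpart₃)
    _ = (p * P + R) * μ K + ((B + B') * ‖g‖ₑ ^ 2 + p * P) * μ bd := by ring
    _ ≤ _ := by gcongr

/-- The integral of the kernel over `K` compared with the sum of its full integrals over `Λ ∩ K`. -/
theorem enorm_integral_sub_tsum_le_tsum_truncationError {d : ℝ} (hd : π.IsFormalDegree μ d)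
    {U : Set G} {N : ℕ} (hU : U ∈ 𝓝 (1 : G)) (hs : IsSeparated Λ U N) {B B' : ℝ≥0∞}
    (hBtop : B ≠ ∞) (hBtop' : B' ≠ ∞) (hB : IsBessel (fun l : Λ => π.op l g) B) {h : Λ → H}
    (hB' : IsBessel h B') {K : Set G} (hK : IsCompact K) :
    ‖∫ x in K, ∑' l, π.kernelTerm g h l x ∂μ - ∑' l : Λ, K.indicator
      (fun _ => (d : ℂ)⁻¹ * inner ℂ (h l) (π.op l g) * ‖g‖ ^ 2) (l : G)‖ₑ ≤
      ∑' l, truncationError π μ g h K l := by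
  have := (hs.countable hU).to_subtype
  have hmeas : ∀ l, Measurable (π.kernelTerm g h l) := π.measurable_kernelTerm g h
  have hfin : ∑' l, ∫⁻ x in K, ‖π.kernelTerm g h l x‖ₑ ∂μ ≠ ∞ := by
    rw [← lintegral_tsum fun l => (hmeas l).enorm.aemeasurable]
    refine ((lintegral_mono fun x => π.tsum_enorm_kernelTerm_le g h hB hB' x).trans_lt ?_).ne
    rw [setLIntegral_const]
    have := hK.measure_lt_top (μ := μ)
    exact ENNReal.mul_lt_top (ENNReal.mul_lt_top (by finiteness) (by simp)) this
  have hint : ∀ l, Integrable (π.kernelTerm g h l) μ := fun l => (hd.2 _ _ _ _).1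
  have hval : ∀ l, ∫ x, π.kernelTerm g h l x ∂μ =
      (d : ℂ)⁻¹ * inner ℂ (h l) (π.op l g) * ‖g‖ ^ 2 := fun l => by
    refine (hd.2 _ _ _ _).2.trans ?_
    rw [inner_conj_symm, inner_self_eq_norm_sq_to_K]
    rfl
  have hsum₁ : Summable fun l => ∫ x in K, π.kernelTerm g h l x ∂μ := by
    refine Summable.of_enorm ?_
    refine ne_top_of_le_ne_top hfin (ENNReal.tsum_le_tsum fun l => ?_)
    exact enorm_integral_le_lintegral_enorm _
  have hsum₂ : Summable fun l : Λ => K.indicator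
      (fun _ => (d : ℂ)⁻¹ * inner ℂ (h l) (π.op l g) * ‖g‖ ^ 2) (l : G) := by
    refine summable_of_hasFiniteSupport
      (((hs.finite_inter_isCompact hU hK).preimage Subtype.val_injective.injOn).subset ?_)
    intro l hl
    exact ⟨l.2, Set.mem_of_indicator_ne_zero hl⟩
  rw [integral_tsum (fun l => (hmeas l).aestronglyMeasurable) hfin, ← hsum₁.tsum_sub hsum₂]
  refine (enorm_tsum_le_tsum_enorm).trans (ENNReal.tsum_le_tsum fun l => ?_)
  by_cases hl : (l : G) ∈ K
  · have hl' : (l : G) ∉ Kᶜ := fun h => h hl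
    rw [Set.indicator_of_mem hl, ← hval, ← integral_add_compl hK.measurableSet (hint l),
      sub_add_cancel_left, enorm_neg]
    simp only [truncationError, Set.indicator_of_mem hl, Set.indicator_of_notMem hl',
      Pi.one_apply, one_mul, zero_mul, add_zero]
    exact enorm_integral_le_lintegral_enorm _
  · have hl' : (l : G) ∈ Kᶜ := hl
    rw [Set.indicator_of_notMem hl, sub_zero]
    simp only [truncationError, Set.indicator_of_mem hl', Set.indicator_of_notMem hl,
      Pi.one_apply, one_mul, zero_mul, zero_add]
    exact enorm_integral_le_lintegral_enorm _

end Estimate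

/-! ### Dual families of frames and Riesz sequences -/

section Dual

variable {H ι : Type*} [NormedAddCommGroup H] [InnerProductSpace ℂ H] {e : ι → H}

theorem lp_norm_sq_eq_tsum (f : lp (fun _ : ι => ℂ) 2) : ‖f‖ ^ 2 = ∑' i, ‖f i‖ ^ 2 := by
  have h := lp.norm_rpow_eq_tsum (by norm_num : 0 < (2 : ℝ≥0∞).toReal) f
  simpa using h

theorem inner_lp_single [DecidableEq ι] (i : ι) (f : lp (fun _ : ι => ℂ) 2) :
    inner ℂ (lp.single 2 i (1 : ℂ)) f = f i := by
  rw [lp.inner_single_left]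
  simp

theorem isBessel_of_apply_eq_inner (R : H →L[ℂ] lp (fun _ : ι => ℂ) 2)
    (hR : ∀ f i, R f i = inner ℂ (e i) f) : IsBessel e (‖R‖ₑ ^ 2) := by
  intro f
  have hsum : Summable fun i => ‖R f i‖ ^ 2 := by
    simpa using (lp.memℓp (R f)).summable (by norm_num : 0 < (2 : ℝ≥0∞).toReal)
  calc ∑' i, ‖inner ℂ (e i) f‖ₑ ^ 2 = ∑' i, ENNReal.ofReal (‖R f i‖ ^ 2) := by
        simp only [← hR, ENNReal.ofReal_pow (norm_nonneg _), ofReal_norm]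
    _ = ‖R f‖ₑ ^ 2 := by
        rw [← ENNReal.ofReal_tsum_of_nonneg (fun i => by positivity) hsum, ← lp_norm_sq_eq_tsum,
          ENNReal.ofReal_pow (norm_nonneg _), ofReal_norm]
    _ ≤ (‖R‖ₑ * ‖f‖ₑ) ^ 2 := by
        gcongr
        exact R.le_opENorm f
    _ = _ := mul_pow _ _ _

variable [CompleteSpace H]

/-- A frame has a dual Bessel sequence whose diagonal pairing with the frame is at most one. -/
theorem IsFrame.exists_dual (he : IsFrame e) : ∃ (R Θ : H →L[ℂ] lp (fun _ : ι => ℂ) 2)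
    (h : ι → H), (∀ f i, R f i = inner ℂ (e i) f) ∧ (∀ f i, Θ f i = inner ℂ (h i) f) ∧
      (∀ f, inner ℂ (R f) (Θ f) = ‖f‖ ^ 2) ∧ ∀ i, ‖inner ℂ (h i) (e i)‖ ≤ 1 := by
  classical
  obtain ⟨A, B, hA, hB, hAB⟩ := he
  have hmem : ∀ f, Memℓp (fun i => inner ℂ (e i) f) 2 := fun f => by
    refine memℓp_gen ?_
    simpa using (hAB f).1
  let R₀ : H →ₗ[ℂ] lp (fun _ : ι => ℂ) 2 :=
    { toFun := fun f => ⟨fun i => inner ℂ (e i) f, hmem f⟩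
      map_add' := fun f f' => lp.ext (funext fun i => inner_add_right _ _ _)
      map_smul' := fun c f => lp.ext (funext fun i => inner_smul_right _ _ _) }
  have hR₀ : ∀ f, ‖R₀ f‖ ^ 2 = ∑' i, ‖inner ℂ (e i) f‖ ^ 2 := fun f => lp_norm_sq_eq_tsum _
  let R := R₀.mkContinuous (Real.sqrt B) fun f => by
    refine le_of_sq_le_sq ?_ (by positivity)
    rw [mul_pow, Real.sq_sqrt hB.le, hR₀]
    exact (hAB f).2.2
  have hR : ∀ f i, R f i = inner ℂ (e i) f := fun f i => rfl
  obtain ⟨Y, hY, hRY⟩ := exists_leftInverse_of_le_norm R hA fun v =>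
    (hAB v).2.1.trans (hR₀ v).ge
  -- The dual vectors are the images under `Y` of the standard unit vectors. The diagonal pairing
  -- is, up to conjugation, a diagonal entry of the projection `R Y`, hence at most one in modulus.
  refine ⟨R, ContinuousLinearMap.adjoint Y, fun i => Y (lp.single 2 i 1), hR, fun f i => ?_,
    fun f => ?_, fun i => ?_⟩
  · rw [← inner_lp_single, ContinuousLinearMap.adjoint_inner_right]
  · rw [ContinuousLinearMap.adjoint_inner_right, hY, inner_self_eq_norm_sq_to_K]
    rfl
  · rw [norm_inner_symm, ← hR]
    refine (lp.norm_apply_le_norm two_ne_zero _ _).trans ((hRY _).trans ?_)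
    rw [lp.norm_single (by norm_num)]
    simp

/-- A Riesz sequence has a biorthogonal Bessel sequence. -/
theorem IsRieszSequence.exists_dual (he : IsRieszSequence e) :
    ∃ (R Θ : H →L[ℂ] lp (fun _ : ι => ℂ) 2) (h : ι → H), (∀ f i, R f i = inner ℂ (e i) f) ∧
      (∀ f i, Θ f i = inner ℂ (h i) f) ∧ (∀ f, ‖inner ℂ (R f) (Θ f)‖ ≤ ‖f‖ ^ 2) ∧
      ∀ i, inner ℂ (h i) (e i) = 1 := by
  classical
  obtain ⟨A, B, hA, hB, hAB⟩ := he
  let T₀ : lp (fun _ : ι => ℂ) 2 →ₗ[ℂ] H :=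
    { toFun := fun c => ∑' i, c i • e i
      map_add' := fun c c' => by
        rw [← (hAB c).1.tsum_add (hAB c').1]
        exact tsum_congr fun i => add_smul _ _ _
      map_smul' := fun a c => by
        rw [RingHom.id_apply, ← (hAB c).1.tsum_const_smul]
        exact tsum_congr fun i => mul_smul _ _ _ }
  let T := T₀.mkContinuous (Real.sqrt B) fun c => by
    refine le_of_sq_le_sq ?_ (by positivity)
    rw [mul_pow, Real.sq_sqrt hB.le]
    exact (hAB c).2.2
  have hT : ∀ i, T (lp.single 2 i 1) = e i := fun i => by
    change ∑' j, (lp.single 2 i (1 : ℂ) : lp (fun _ : ι => ℂ) 2) j • e j = e i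
    rw [tsum_eq_single i fun j hj => by rw [lp.single_apply_ne _ _ _ hj, zero_smul],
      lp.single_apply_self, one_smul]
  obtain ⟨Y, hY, hTY⟩ := exists_leftInverse_of_le_norm T hA fun c => (hAB c).2.1
  have hYi : ∀ f i, Y f i = inner ℂ (ContinuousLinearMap.adjoint Y (lp.single 2 i 1)) f :=
    fun f i => by rw [ContinuousLinearMap.adjoint_inner_left, inner_lp_single]
  -- Here `⟨T* f, Y f⟩ = ⟨f, T Y f⟩` with `T Y` a projection, and biorthogonality on the diagonal is
  -- `Y T = 1`.
  refine ⟨ContinuousLinearMap.adjoint T, Y,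
    fun i => ContinuousLinearMap.adjoint Y (lp.single 2 i 1), fun f i => ?_, hYi, fun f => ?_,
    fun i => ?_⟩
  · rw [← inner_lp_single, ContinuousLinearMap.adjoint_inner_right, hT]
  · rw [ContinuousLinearMap.adjoint_inner_left]
    refine (norm_inner_le_norm _ _).trans ?_
    rw [sq]
    gcongr
    exact hTY f
  · rw [← hYi, ← hT, hY, lp.single_apply_self]

end Dual

/-! ### Existence of Beurling densities -/

section Density

variable {G : Type*} [Group G] [TopologicalSpace G] [IsTopologicalGroup G]
  [MeasurableSpace G] [BorelSpace G] {μ : Measure G} {Λ : Set G}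

/-- Tonelli, since `l ∈ y M` exactly when `y ∈ l M⁻¹`. -/
theorem setLIntegral_encard_inter_smul [T2Space G] (hΛ : Λ.Countable) {A M : Set G}
    (hM : IsCompact M) :
    ∫⁻ y in A, ((Λ ∩ y • M).encard : ℝ≥0∞) ∂μ = ∑' l : Λ, μ (((l : G) • M⁻¹) ∩ A) := by
  have := hΛ.to_subtype
  have hlM : ∀ l : Λ, MeasurableSet ((l : G) • M⁻¹) := fun l =>
    (hM.inv.smul (l : G)).measurableSet
  have hind : ∀ (l : Λ) y, (y • M).indicator (1 : G → ℝ≥0∞) (l : G) =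
      ((l : G) • M⁻¹).indicator 1 y := by
    intro l y
    have hiff : (l : G) ∈ y • M ↔ y ∈ (l : G) • M⁻¹ := by
      rw [Set.mem_smul_set_iff_inv_smul_mem, Set.mem_smul_set_iff_inv_smul_mem,
        smul_eq_mul, smul_eq_mul, Set.mem_inv, mul_inv_rev, inv_inv]
    by_cases hy : (l : G) ∈ y • M
    · rw [Set.indicator_of_mem hy, Set.indicator_of_mem (hiff.1 hy)]
      rfl
    · rw [Set.indicator_of_notMem hy, Set.indicator_of_notMem (mt hiff.2 hy)]
  simp only [← tsum_indicator_one, hind]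
  rw [lintegral_tsum fun l => (measurable_one.indicator (hlM l)).aemeasurable]
  refine tsum_congr fun l => ?_
  rw [lintegral_indicator_one (hlM l), Measure.restrict_apply (hlM l)]

variable [LocallyCompactSpace G] [SecondCountableTopology G] [μ.IsHaarMeasure]
  [μ.IsMulRightInvariant]

theorem measure_smul_inv (l : G) (M : Set G) : μ (l • M⁻¹) = μ M := by
  have := isInvInvariant_of_isMulRightInvariant μ
  rw [measure_smul, Measure.measure_inv]

variable [T2Space G]

/-- Lower averages over `M` bound the number of points in `x K M` from below. -/
theorem mul_measure_le_encard (hΛ : Λ.Countable) {K M : Set G} (hM : IsCompact M) (hM0 : μ M ≠ 0)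
    {a : ℝ≥0∞} (ha : ∀ y : G, a ≤ ((Λ ∩ y • M).encard : ℝ≥0∞) / μ M) (x : G) :
    a * μ K ≤ ((Λ ∩ x • (K * M)).encard : ℝ≥0∞) := by
  have hMtop : μ M ≠ ∞ := hM.measure_lt_top.ne
  refine (ENNReal.mul_le_mul_iff_left hM0 hMtop).1 ?_
  calc a * μ K * μ M = ∫⁻ y in x • K, a * μ M ∂μ := by
        rw [setLIntegral_const, measure_smul]; ring
    _ ≤ ∫⁻ y in x • K, ((Λ ∩ y • M).encard : ℝ≥0∞) ∂μ :=
        lintegral_mono fun y => ENNReal.mul_le_of_le_div (ha y)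
    _ = ∑' l : Λ, μ (((l : G) • M⁻¹) ∩ x • K) := setLIntegral_encard_inter_smul hΛ hM
    _ ≤ ∑' l : Λ, (x • (K * M)).indicator 1 (l : G) * μ M := by
        refine ENNReal.tsum_le_tsum fun l => ?_
        by_cases hl : (l : G) ∈ x • (K * M)
        · rw [Set.indicator_of_mem hl, Pi.one_apply, one_mul, ← measure_smul_inv (l : G) M]
          exact measure_mono Set.inter_subset_left
        · have : ((l : G) • M⁻¹) ∩ x • K = ∅ := by
            refine Set.eq_empty_of_forall_notMem ?_
            rintro y ⟨⟨m, hm, rfl⟩, hy⟩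
            refine hl ?_
            rw [← smul_mul_assoc]
            exact ⟨_, hy, m⁻¹, hm, by simp⟩
          simp [this]
    _ = _ := by rw [ENNReal.tsum_mul_right, tsum_indicator_one]

/-- Upper averages over `M` bound the number of points in `x K` from above. -/
theorem encard_le_mul_measure (hΛ : Λ.Countable) {K M : Set G} (hM : IsCompact M) (hM0 : μ M ≠ 0)
    {a : ℝ≥0∞} (ha : ∀ y : G, ((Λ ∩ y • M).encard : ℝ≥0∞) / μ M ≤ a) (x : G) :
    ((Λ ∩ x • K).encard : ℝ≥0∞) ≤ a * μ (K * M⁻¹) := by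
  have hMtop : μ M ≠ ∞ := hM.measure_lt_top.ne
  refine (ENNReal.mul_le_mul_iff_left hM0 hMtop).1 ?_
  calc ((Λ ∩ x • K).encard : ℝ≥0∞) * μ M
      = ∑' l : Λ, (x • K).indicator 1 (l : G) * μ M := by
        rw [ENNReal.tsum_mul_right, tsum_indicator_one]
    _ ≤ ∑' l : Λ, μ (((l : G) • M⁻¹) ∩ x • (K * M⁻¹)) := by
        refine ENNReal.tsum_le_tsum fun l => ?_
        by_cases hl : (l : G) ∈ x • K
        · rw [Set.indicator_of_mem hl, Pi.one_apply, one_mul, Set.inter_eq_left.2,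
            measure_smul_inv]
          rintro _ ⟨m, hm, rfl⟩
          rw [← smul_mul_assoc]
          exact ⟨_, hl, m, hm, rfl⟩
        · simp [hl]
    _ = ∫⁻ y in x • (K * M⁻¹), ((Λ ∩ y • M).encard : ℝ≥0∞) ∂μ :=
        (setLIntegral_encard_inter_smul hΛ hM).symm
    _ ≤ ∫⁻ y in x • (K * M⁻¹), a * μ M ∂μ :=
        lintegral_mono fun y => (ENNReal.div_le_iff hM0 hMtop).1 (ha y)
    _ = a * μ (K * M⁻¹) * μ M := by rw [setLIntegral_const, measure_smul]; ring

/-- Averaging over translates of `K m` bounds the `n`-th supremum by the `m`-th one times `1 +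
o(1)`. Hence the limsup is at most every term, and so at most the liminf. -/
theorem IsStrongFolner.exists_hasUpperBeurlingDensity {K : ℕ → Set G} (hK : IsStrongFolner μ K)
    (hΛ : Λ.Countable) : ∃ D, HasUpperBeurlingDensity μ K Λ D := by
  set D : ℕ → ℝ≥0∞ := fun n => ⨆ x : G, ((Λ ∩ x • K n).encard : ℝ≥0∞) / μ (K n) with hD
  have hle : ∀ m, limsup D atTop ≤ D m := by
    intro m
    have hL : IsCompact ((K m)⁻¹ ∪ {1}) := (hK.isCompact m).inv.union isCompact_singleton
    have hlim := ((hK.tendsto _ hL).const_add 1)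
    rw [add_zero] at hlim
    have hlim' := ENNReal.Tendsto.const_mul (a := D m) hlim (Or.inl one_ne_zero)
    rw [mul_one] at hlim'
    rw [← hlim'.limsup_eq]
    refine limsup_le_limsup (Eventually.of_forall fun n => iSup_le fun x => ?_)
    have hn0 := hK.nonnull n
    have hntop : μ (K n) ≠ ∞ := (hK.isCompact n).measure_lt_top.ne
    rw [ENNReal.div_le_iff hn0 hntop, mul_assoc, add_mul, one_mul, ENNReal.div_mul_cancel hn0 hntop]
    refine (encard_le_mul_measure hΛ (hK.isCompact m) (hK.nonnull m)
      (fun y => le_iSup (fun x : G => ((Λ ∩ x • K m).encard : ℝ≥0∞) / μ (K m)) y) x).trans ?_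
    gcongr
    exact (measure_mono (mul_subset_union_boundary (by simp)
      Set.subset_union_left)).trans (measure_union_le _ _)
  exact ⟨_, tendsto_of_le_liminf_of_limsup_le
    (le_liminf_of_le (by isBoundedDefault) (Eventually.of_forall hle)) le_rfl⟩

/-- The same averaging from below counts points in `x K_n K_m` instead of `x K_n`. The surplus lies
near the boundary of `x K_n`, and bounding its cardinality by its measure requires separation. -/
theorem IsStrongFolner.exists_hasLowerBeurlingDensity {K : ℕ → Set G} (hK : IsStrongFolner μ K)
    {U₀ : Set G} {N : ℕ} (hU₀ : U₀ ∈ 𝓝 (1 : G)) (hs₀ : IsSeparated Λ U₀ N) :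
    ∃ D, HasLowerBeurlingDensity μ K Λ D := by
  have hΛ := hs₀.countable hU₀
  obtain ⟨U, hUopen, hU1, hUsymm, hUsub, hUc⟩ := exists_open_symm_subset_isCompact_closure hU₀
  have hs := hs₀.mono hUsub
  have hUpos : μ U ≠ 0 := (hUopen.measure_pos μ ⟨1, hU1⟩).ne'
  have hUtop : μ U ≠ ∞ := ((measure_mono subset_closure).trans_lt hUc.measure_lt_top).ne
  set p : ℝ≥0∞ := N / μ U with hp
  have hptop : p ≠ ∞ := ENNReal.div_ne_top (by simp) hUpos
  set D : ℕ → ℝ≥0∞ := fun n => ⨅ x : G, ((Λ ∩ x • K n).encard : ℝ≥0∞) / μ (K n) with hD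
  have hle : ∀ m, D m ≤ liminf D atTop := by
    intro m
    -- Points of `K_n K_m` outside `K_n`, fattened by `U`, lie in `K_n L` by the first piece and in
    -- `K_nᶜ L` by the second.
    set L := K m * closure U ∪ closure U with hLdef
    have hL : IsCompact L := ((hK.isCompact m).mul hUc).union hUc
    have hlim := ENNReal.Tendsto.const_mul (a := p) (hK.tendsto _ hL) (Or.inr hptop)
    rw [mul_zero] at hlim
    have hlim' := ENNReal.Tendsto.sub (tendsto_const_nhds (x := D m)) hlim
      (Or.inr ENNReal.zero_ne_top)
    rw [tsub_zero] at hlim'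
    rw [← hlim'.liminf_eq]
    refine liminf_le_liminf (Eventually.of_forall fun n => le_iInf fun x => ?_)
    have hn0 := hK.nonnull n
    have hntop : μ (K n) ≠ ∞ := (hK.isCompact n).measure_lt_top.ne
    rw [tsub_le_iff_right, mul_div_assoc', ← ENNReal.add_div,
      ENNReal.le_div_iff_mul_le (Or.inl hn0) (Or.inl hntop)]
    refine (mul_measure_le_encard hΛ (hK.isCompact m) (hK.nonnull m)
      (fun y => iInf_le (fun x : G => ((Λ ∩ x • K m).encard : ℝ≥0∞) / μ (K m)) y) x).trans ?_
    have hcover : Λ ∩ x • (K n * K m) ⊆ (Λ ∩ x • K n) ∪ (Λ ∩ x • ((K n * K m) \ K n)) := by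
      rintro _ ⟨hy, z, hz, rfl⟩
      by_cases hzn : z ∈ K n
      · exact Or.inl ⟨hy, z, hzn, rfl⟩
      · exact Or.inr ⟨hy, z, ⟨hz, hzn⟩, rfl⟩
    have hcard : ((Λ ∩ x • (K n * K m)).encard : ℝ≥0∞) ≤
        (Λ ∩ x • K n).encard + (Λ ∩ x • ((K n * K m) \ K n)).encard := by
      exact_mod_cast (Set.encard_le_encard hcover).trans (Set.encard_union_le _ _)
    refine hcard.trans (add_le_add le_rfl ?_)
    rw [hp, ENNReal.mul_comm_div, mul_div_assoc',
      ENNReal.le_div_iff_mul_le (Or.inl hUpos) (Or.inl hUtop)]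
    refine (hs.encard_mul_measure_le hUopen hU1 hUsymm μ _).trans (mul_le_mul_right ?_ _)
    rw [smul_mul_assoc, measure_smul]
    refine measure_mono ?_
    rintro _ ⟨z, ⟨⟨k, hk, k', hk', rfl⟩, hz'⟩, u, hu, rfl⟩
    refine ⟨⟨k, hk, k' * u, Or.inl ⟨k', hk', u, subset_closure hu, rfl⟩, (mul_assoc _ _ _).symm⟩,
      ⟨_, hz', u, Or.inr (subset_closure hu), rfl⟩⟩
  exact ⟨_, tendsto_of_le_liminf_of_limsup_le le_rfl
    (limsup_le_of_le (by isBoundedDefault) (Eventually.of_forall hle))⟩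

end Density

/-- Expresses the kernel through the dual pair at `f = π x g`, whose norm is `‖g‖` for all `x`; this
gives the pointwise value or bound of the kernel. -/
theorem tsum_kernelTerm_eq_inner {G H : Type*} [Group G] [MeasurableSpace G]
    [NormedAddCommGroup H] [InnerProductSpace ℂ H] {π : ProjectiveRep G H} {Λ : Set G} {g : H}
    {R Θ : H →L[ℂ] lp (fun _ : Λ => ℂ) 2} {h : Λ → H}
    (hR : ∀ f i, R f i = inner ℂ (π.op i g) f) (hΘ : ∀ f i, Θ f i = inner ℂ (h i) f) (x : G) :
    ∑' l, π.kernelTerm g h l x = inner ℂ (R (π.op x g)) (Θ (π.op x g)) := by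
  rw [lp.inner_eq_tsum]
  refine tsum_congr fun l => ?_
  rw [RCLike.inner_apply', hR, hΘ, inner_conj_symm]
  simp only [ProjectiveRep.kernelTerm, ProjectiveRep.coeff, inner_conj_symm]

/-! ### Comparison of point counts with measure -/

section Comparison

variable {G H : Type*} [Group G] [TopologicalSpace G] [IsTopologicalGroup G] [T2Space G]
  [SecondCountableTopology G] [MeasurableSpace G] [BorelSpace G]
  [NormedAddCommGroup H] [InnerProductSpace ℂ H]
  {π : ProjectiveRep G H} {μ : Measure G} [μ.IsHaarMeasure] {Λ : Set G} {g : H}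

/-- Along a strong Følner sequence the total truncation error is negligible, uniformly in the
translations. -/
theorem IsStrongFolner.eventually_tsum_truncationError_le [LocallyCompactSpace G]
    [TopologicalSpace.SeparableSpace H] {K : ℕ → Set G}
    (hK : IsStrongFolner μ K) {d : ℝ} (hd : π.IsFormalDegree μ d) (hg : g ∈ π.localized μ)
    {U : Set G} {N : ℕ} (hU : U ∈ 𝓝 (1 : G)) (hs : IsSeparated Λ U N) {B B' : ℝ≥0∞}
    (hBtop : B ≠ ∞) (hBtop' : B' ≠ ∞) (hB : IsBessel (fun l : Λ => π.op l g) B) {h : Λ → H}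
    (hB' : IsBessel h B') {η : ℝ≥0∞} (hη : η ≠ 0) :
    ∀ᶠ n in atTop, ∀ x : G, ∑' l, truncationError π μ g h (x • K n) l ≤ η * μ (K n) := by
  have hη2 : η / 2 ≠ 0 := by simpa using hη
  obtain ⟨L, hL, C, hC, hE⟩ :=
    exists_tsum_truncationError_le hd hg hU hs hBtop hBtop' hB hB' hη2
  have hlim := ENNReal.Tendsto.const_mul (a := C) (hK.tendsto L hL) (Or.inr hC)
  rw [mul_zero] at hlim
  filter_upwards [hlim.eventually_lt_const (pos_iff_ne_zero.2 hη2)] with n hn x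
  have hn0 := hK.nonnull n
  have hntop : μ (K n) ≠ ∞ := (hK.isCompact n).measure_lt_top.ne
  refine (hE _ ((hK.isCompact n).smul x)).trans ?_
  rw [← Set.smul_set_compl, smul_mul_assoc, smul_mul_assoc, ← Set.smul_set_inter, measure_smul,
    measure_smul]
  calc η / 2 * μ (K n) + C * μ (K n * L ∩ ((K n)ᶜ * L))
      ≤ η / 2 * μ (K n) + η / 2 * μ (K n) := by
        refine add_le_add le_rfl ?_
        rw [mul_div_assoc'] at hn
        exact (ENNReal.div_le_iff hn0 hntop).1 hn.le
    _ = η * μ (K n) := by rw [← add_mul, ENNReal.add_halves]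

/-- For a system with a dual whose diagonal pairing is at most one, compact sets contain enough
points. -/
theorem ofReal_mul_measure_le_encard_add {d : ℝ} (hd : π.IsFormalDegree μ d) (hg0 : g ≠ 0)
    {U : Set G} {N : ℕ} (hU : U ∈ 𝓝 (1 : G)) (hs : IsSeparated Λ U N)
    {R Θ : H →L[ℂ] lp (fun _ : Λ => ℂ) 2} {h : Λ → H} (hR : ∀ f i, R f i = inner ℂ (π.op i g) f)
    (hΘ : ∀ f i, Θ f i = inner ℂ (h i) f) (hRΘ : ∀ f, inner ℂ (R f) (Θ f) = ‖f‖ ^ 2)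
    (hdiag : ∀ i : Λ, ‖inner ℂ (h i) (π.op i g)‖ ≤ 1) {K : Set G} (hK : IsCompact K) {η : ℝ≥0∞}
    (hE : ∑' l, truncationError π μ g h K l ≤ ENNReal.ofReal d⁻¹ * ‖g‖ₑ ^ 2 * η * μ K) :
    ENNReal.ofReal d * μ K ≤ ((Λ ∩ K).encard : ℝ≥0∞) + η * μ K := by
  -- `q` is the modulus of the full integral of a kernel term with unit diagonal pairing; errors are
  -- measured in units of `q` so that it cancels at the end.
  set q := ENNReal.ofReal d⁻¹ * ‖g‖ₑ ^ 2 with hq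
  have hq0 : q ≠ 0 := by simp [hq, hd.1, hg0]
  have hqtop : q ≠ ∞ := by finiteness
  have hqd : q * ENNReal.ofReal d = ‖g‖ₑ ^ 2 := by
    rw [hq, mul_right_comm, ← ENNReal.ofReal_mul (inv_nonneg.2 hd.1.le),
      inv_mul_cancel₀ hd.1.ne', ENNReal.ofReal_one, one_mul]
  have hint := enorm_integral_sub_tsum_le_tsum_truncationError hd hU hs (by finiteness)
    (by finiteness) (isBessel_of_apply_eq_inner R hR) (isBessel_of_apply_eq_inner Θ hΘ) hK
  simp only [tsum_kernelTerm_eq_inner hR hΘ, hRΘ, LinearIsometryEquiv.norm_map] at hint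
  set S := ∑' l : Λ, K.indicator
    (fun _ => (d : ℂ)⁻¹ * inner ℂ (h l) (π.op l g) * ‖g‖ ^ 2) (l : G) with hSdef
  have hS : ‖S‖ₑ ≤ q * ((Λ ∩ K).encard : ℝ≥0∞) := by
    rw [← tsum_indicator_one, ← ENNReal.tsum_mul_left]
    refine enorm_tsum_le_tsum_enorm.trans (ENNReal.tsum_le_tsum fun l => ?_)
    by_cases hl : (l : G) ∈ K
    · rw [Set.indicator_of_mem hl, Set.indicator_of_mem hl, Pi.one_apply, mul_one, hq,
        ← ofReal_norm, ← ofReal_norm, ← ENNReal.ofReal_pow (norm_nonneg _),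
        ← ENNReal.ofReal_mul (inv_nonneg.2 hd.1.le)]
      refine ENNReal.ofReal_le_ofReal ?_
      rw [norm_mul, norm_mul, norm_inv, norm_pow, Complex.norm_real, Complex.norm_real, norm_norm,
        Real.norm_of_nonneg hd.1.le]
      have := hd.1
      gcongr
      exact mul_le_of_le_one_right (by positivity) (hdiag l)
    · simp [hl]
  have hI : ‖∫ _ in K, (‖g‖ : ℂ) ^ 2 ∂μ‖ₑ = ‖g‖ₑ ^ 2 * μ K := by
    rw [setIntegral_const, enorm_smul, enorm_pow, ← ofReal_norm (‖g‖ : ℂ), Complex.norm_real,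
      norm_norm, ofReal_norm, mul_comm, Measure.real, Real.enorm_of_nonneg ENNReal.toReal_nonneg,
      ENNReal.ofReal_toReal hK.measure_lt_top.ne]
  refine (ENNReal.mul_le_mul_iff_right hq0 hqtop).1 ?_
  calc q * (ENNReal.ofReal d * μ K) = ‖∫ _ in K, (‖g‖ : ℂ) ^ 2 ∂μ‖ₑ := by
        rw [hI, ← mul_assoc, hqd]
    _ ≤ ‖S‖ₑ + ‖∫ _ in K, (‖g‖ : ℂ) ^ 2 ∂μ - S‖ₑ := by
        refine le_trans (le_of_eq ?_) (enorm_add_le _ _)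
        rw [add_sub_cancel]
    _ ≤ q * ((Λ ∩ K).encard : ℝ≥0∞) + q * η * μ K := add_le_add hS (hint.trans hE)
    _ = _ := by ring

/-- For a system with a biorthogonal system, compact sets contain few points. -/
theorem encard_le_ofReal_mul_measure_add {d : ℝ} (hd : π.IsFormalDegree μ d) (hg0 : g ≠ 0)
    {U : Set G} {N : ℕ} (hU : U ∈ 𝓝 (1 : G)) (hs : IsSeparated Λ U N)
    {R Θ : H →L[ℂ] lp (fun _ : Λ => ℂ) 2} {h : Λ → H} (hR : ∀ f i, R f i = inner ℂ (π.op i g) f)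
    (hΘ : ∀ f i, Θ f i = inner ℂ (h i) f) (hRΘ : ∀ f, ‖inner ℂ (R f) (Θ f)‖ ≤ ‖f‖ ^ 2)
    (hdiag : ∀ i : Λ, inner ℂ (h i) (π.op i g) = 1) {K : Set G} (hK : IsCompact K) {η : ℝ≥0∞}
    (hE : ∑' l, truncationError π μ g h K l ≤ ENNReal.ofReal d⁻¹ * ‖g‖ₑ ^ 2 * η * μ K) :
    ((Λ ∩ K).encard : ℝ≥0∞) ≤ ENNReal.ofReal d * μ K + η * μ K := by
  set q := ENNReal.ofReal d⁻¹ * ‖g‖ₑ ^ 2 with hq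
  have hq0 : q ≠ 0 := by simp [hq, hd.1, hg0]
  have hqtop : q ≠ ∞ := by finiteness
  have hqd : q * ENNReal.ofReal d = ‖g‖ₑ ^ 2 := by
    rw [hq, mul_right_comm, ← ENNReal.ofReal_mul (inv_nonneg.2 hd.1.le),
      inv_mul_cancel₀ hd.1.ne', ENNReal.ofReal_one, one_mul]
  have hint := enorm_integral_sub_tsum_le_tsum_truncationError hd hU hs (by finiteness)
    (by finiteness) (isBessel_of_apply_eq_inner R hR) (isBessel_of_apply_eq_inner Θ hΘ) hK
  simp only [tsum_kernelTerm_eq_inner hR hΘ, hdiag, mul_one] at hint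
  set I := ∫ x in K, inner ℂ (R (π.op x g)) (Θ (π.op x g)) ∂μ with hIdef
  set S := ∑' l : Λ, K.indicator (fun _ => (d : ℂ)⁻¹ * (‖g‖ : ℂ) ^ 2) (l : G) with hSdef
  -- An equality: all diagonal pairings are one, so there is no cancellation in the finite sum.
  have hS : ‖S‖ₑ = q * ((Λ ∩ K).encard : ℝ≥0∞) := by
    have hfin := hs.finite_inter_isCompact hU hK
    rw [hSdef, tsum_subtype Λ (K.indicator fun _ => (d : ℂ)⁻¹ * (‖g‖ : ℂ) ^ 2),
      Set.indicator_indicator, ← tsum_subtype, tsum_const, Nat.card_coe_set_eq,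
      ← hfin.cast_ncard_eq, nsmul_eq_mul, enorm_mul, mul_comm]
    congr 1
    · rw [hq, ← ofReal_norm, ← ofReal_norm, ← ENNReal.ofReal_pow (norm_nonneg _),
        ← ENNReal.ofReal_mul (inv_nonneg.2 hd.1.le), norm_mul, norm_inv, norm_pow,
        Complex.norm_real, Complex.norm_real, norm_norm, Real.norm_of_nonneg hd.1.le]
    · simp [← ofReal_norm]
  have hI : ‖I‖ₑ ≤ ‖g‖ₑ ^ 2 * μ K := by
    refine (enorm_integral_le_lintegral_enorm _).trans ?_
    rw [← setLIntegral_const]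
    refine lintegral_mono fun x => ?_
    rw [← ofReal_norm, ← ofReal_norm, ← ENNReal.ofReal_pow (norm_nonneg _)]
    refine ENNReal.ofReal_le_ofReal ((hRΘ _).trans ?_)
    rw [LinearIsometryEquiv.norm_map]
  refine (ENNReal.mul_le_mul_iff_right hq0 hqtop).1 ?_
  calc q * ((Λ ∩ K).encard : ℝ≥0∞) = ‖I - (I - S)‖ₑ := by rw [sub_sub_cancel, hS]
    _ ≤ ‖I‖ₑ + ‖I - S‖ₑ := enorm_sub_le
    _ ≤ ‖g‖ₑ ^ 2 * μ K + q * η * μ K := add_le_add hI (hint.trans hE)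
    _ = _ := by rw [← hqd]; ring

theorem le_density_of_isFrame [TopologicalSpace.SeparableSpace H] [LocallyCompactSpace G]
    [CompleteSpace H] [μ.IsMulRightInvariant] {d : ℝ} (hd : π.IsFormalDegree μ d) {K : ℕ → Set G}
    (hK : IsStrongFolner μ K) (hg : g ∈ π.localized μ) (hg0 : g ≠ 0)
    (he : IsFrame fun l : Λ => π.op l g) :
    ∃ D : ℝ≥0∞, HasLowerBeurlingDensity μ K Λ D ∧ ENNReal.ofReal d ≤ D := by
  obtain ⟨R, Θ, h, hR, hΘ, hRΘ, hdiag⟩ := he.exists_dual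
  have hB := isBessel_of_apply_eq_inner R hR
  obtain ⟨U, hU, N, hs⟩ := exists_isSeparated_of_isBessel π μ hg0 (by finiteness) hB
  obtain ⟨D, hD⟩ := hK.exists_hasLowerBeurlingDensity hU hs
  refine ⟨D, hD, ENNReal.le_of_forall_pos_le_add fun η hη _ => ?_⟩
  have hη0 : ENNReal.ofReal d⁻¹ * ‖g‖ₑ ^ 2 * η ≠ 0 := by simp [hd.1, hg0, hη.ne']
  refine ge_of_tendsto (hD.add_const _) ?_
  filter_upwards [hK.eventually_tsum_truncationError_le hd hg hU hs (by finiteness)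
    (by finiteness) hB (isBessel_of_apply_eq_inner Θ hΘ) hη0] with n hn
  rw [← tsub_le_iff_right]
  refine le_iInf fun x => ?_
  have hn0 := hK.nonnull n
  have hntop : μ (K n) ≠ ∞ := (hK.isCompact n).measure_lt_top.ne
  have h₁ := ofReal_mul_measure_le_encard_add hd hg0 hU hs hR hΘ hRΘ hdiag
    ((hK.isCompact n).smul x) (η := η) (by rw [measure_smul]; exact hn x)
  rw [measure_smul] at h₁
  rwa [tsub_le_iff_right, ← ENNReal.mul_div_cancel_right hn0 hntop (a := (η : ℝ≥0∞)),
    ← ENNReal.add_div, ENNReal.le_div_iff_mul_le (Or.inl hn0) (Or.inl hntop)]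

theorem density_le_of_isRieszSequence [TopologicalSpace.SeparableSpace H] [LocallyCompactSpace G]
    [CompleteSpace H] [μ.IsMulRightInvariant] {d : ℝ} (hd : π.IsFormalDegree μ d) {K : ℕ → Set G}
    (hK : IsStrongFolner μ K) (hg : g ∈ π.localized μ) (hg0 : g ≠ 0)
    (he : IsRieszSequence fun l : Λ => π.op l g) :
    ∃ D : ℝ≥0∞, HasUpperBeurlingDensity μ K Λ D ∧ D ≤ ENNReal.ofReal d := by
  obtain ⟨R, Θ, h, hR, hΘ, hRΘ, hdiag⟩ := he.exists_dual
  have hB := isBessel_of_apply_eq_inner R hR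
  obtain ⟨U, hU, N, hs⟩ := exists_isSeparated_of_isBessel π μ hg0 (by finiteness) hB
  obtain ⟨D, hD⟩ := hK.exists_hasUpperBeurlingDensity (hs.countable hU)
  refine ⟨D, hD, ENNReal.le_of_forall_pos_le_add fun η hη _ => ?_⟩
  have hη0 : ENNReal.ofReal d⁻¹ * ‖g‖ₑ ^ 2 * η ≠ 0 := by simp [hd.1, hg0, hη.ne']
  refine le_of_tendsto hD ?_
  filter_upwards [hK.eventually_tsum_truncationError_le hd hg hU hs (by finiteness)
    (by finiteness) hB (isBessel_of_apply_eq_inner Θ hΘ) hη0] with n hn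
  refine iSup_le fun x => ?_
  have h₁ := encard_le_ofReal_mul_measure_add hd hg0 hU hs hR hΘ hRΘ hdiag
    ((hK.isCompact n).smul x) (η := η) (by rw [measure_smul]; exact hn x)
  rw [measure_smul, ← add_mul] at h₁
  exact ENNReal.div_le_of_le_mul h₁

end Comparison

end Coherent

/-! ### The density theorem -/

theorem theorem3p5 {G H : Type*}
    [Group G] [TopologicalSpace G] [IsTopologicalGroup G] [T2Space G] [LocallyCompactSpace G]
    [SecondCountableTopology G] [MeasurableSpace G] [BorelSpace G]
    (μ : MeasureTheory.Measure G) [μ.IsHaarMeasure] [μ.IsMulRightInvariant]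
    [NormedAddCommGroup H] [InnerProductSpace ℂ H] [CompleteSpace H]
    [TopologicalSpace.SeparableSpace H]
    (π : Coherent.ProjectiveRep G H) (hπ : π.IsDiscreteSeries μ) :
    (∃! d : ℝ, π.IsFormalDegree μ d) ∧
    ∀ d : ℝ, π.IsFormalDegree μ d →
    ∀ K : ℕ → Set G, Coherent.IsStrongFolner μ K →
    ∀ (Λ : Set G) (g : H), g ∈ π.localized μ →
      (Coherent.IsFrame (fun l : Λ => π.op l g) →
        ∃ D : ℝ≥0∞, Coherent.HasLowerBeurlingDensity μ K Λ D ∧ ENNReal.ofReal d ≤ D) ∧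
      (Coherent.IsRieszSequence (fun l : Λ => π.op l g) →
        ∃ D : ℝ≥0∞, Coherent.HasUpperBeurlingDensity μ K Λ D ∧ D ≤ ENNReal.ofReal d) := by
  refine ⟨hπ.existsUnique_isFormalDegree μ, fun d hd K hK Λ g hg => ?_⟩
  obtain ⟨-, v, hv, -⟩ := hπ
  -- The zero vector is not excluded from the localized vectors: it cannot generate a frame as `H ≠
  -- 0`, and it generates a Riesz sequence only for `Λ = ∅`, with density zero.
  by_cases hg0 : g = 0
  · subst hg0
    refine ⟨fun ⟨A, B, hA, _, h⟩ => ?_, fun ⟨A, B, hA, _, h⟩ => ?_⟩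
    · have h₁ := (h v).2.1
      simp only [map_zero, inner_zero_left, norm_zero, ne_eq, OfNat.ofNat_ne_zero,
        not_false_eq_true, zero_pow, tsum_zero] at h₁
      have := norm_pos_iff.2 hv
      exact absurd h₁ (not_le.2 (by positivity))
    · classical
      obtain rfl : Λ = ∅ := by
        refine Set.eq_empty_of_forall_notMem fun l hl => ?_
        have h₁ := (h (lp.single 2 ⟨l, hl⟩ 1)).2.1
        simp only [map_zero, smul_zero, tsum_zero, norm_zero, ne_eq, OfNat.ofNat_ne_zero,
          not_false_eq_true, zero_pow, lp.norm_single (two_pos : (0 : ℝ≥0∞) < 2), norm_one,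
          one_pow, mul_one] at h₁
        exact absurd h₁ (not_le.2 hA)
      refine ⟨0, ?_, zero_le⟩
      simp [Coherent.HasUpperBeurlingDensity]
  · exact ⟨Coherent.le_density_of_isFrame hd hK hg hg0,
      Coherent.density_le_of_isRieszSequence hd hK hg hg0⟩
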